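/- **Setting.** A network consists of $n$ agents, a nonnegative row-stochastic matrix $R\in\mathbb R^{n\times n}$ and a nonnegative column-stochastic matrix $C\in\mathbb R^{n\times n}$. The induced graph of a nonnegative matrix $A$ has the edge $(i,j)$ iff $A_{ji}>0$; let $\mathcal R_A$ be the set of roots of its spanning trees (directed from the root). A root eigenvector of a row-stochastic $A$ is a vector $\pi\ge 0$ with $\pi^{\mathsf T}A=\pi^{\mathsf T}$, $\|\pi\|_1=1$ and $\pi(i)=0$ for $i\notin\mathcal R_A$; $A$ is exponentially decaying if there are $\alpha\in(0,1)$, an integer $m>0$ and a root eigenvector $\pi$ with $\|A^t-\mathbf 1\pi^{\mathsf T}\|_2\le\alpha^t$ for all $t\ge m$. Assume that $\mathcal R_R\cap\mathcal R_{C^{\mathsf T}}\neq\emptyset$ and that $R$ and $C^{\mathsf T}$ are exponentially decaying, and let $\pi_R,\pi_C$ be the (unique) root eigenvectors of $R$ and $C^{\mathsf T}$. Put $$M_1=\|\pi_R^{\mathsf T}C\|_2^2+\sum_{t\ge1}\|\pi_R^{\mathsf T}(C^{t+1}-C^t)\|_2^2,\qquad M_2=\sum_{t\ge1}t\,\|\pi_R^{\mathsf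 T}(C^{t+1}-C^t)\|_2,$$ let $\tilde M_2=0$ if $R$ and $C^{\mathsf T}$ are the $0$-$1$ matrices of two spanning trees with a common root (each node gives weight $1$ to its parent, the root to itself), $\tilde M_2=M_2$ otherwise, and let $Q=\max\{M_1,\tilde M_2,M_1\tilde M_2\}$. Agent $i$ has an objective $f_i:\mathbb R^p\to\mathbb R$, bounded below with $L$-Lipschitz gradient ($L>0$), and stochastic gradients $g_i(x,\xi_i)$, $\xi_i\sim\mathcal D_i$, with $\mathbb E\,g_i(x,\xi_i)=\nabla f_i(x)$ and $\mathbb E\|g_i(x,\xi_i)-\nabla f_i(x)\|^2\le\sigma^2$ for all $x$ ($\sigma>0$). Let $f=\frac1n\sum_i f_i$. Stochastic Push-Pull with stepsize $\gamma$ starts from $x_i^{(0)}=x^{(0)}$ for all $i$ and $Y^{(0)}=G^{(0)}$, and iterates $$X^{(t+1)}=R\,(X^{(t)}-\gamma Y^{(t)}),\qquad Y^{(t+1)}=C\,(Y^{(t)}+G^{(t+1)}-G^{(t)}),$$ where row $i$ of $G^{(t)}$ is $g_i(x_i^{(t)},\xi_i^{(t)})$ and the samples $\xi_i^{(t)}\sim\mathcal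 D_i$ are independent over all $i$ and $t$. Let $\hat x^{(t)}=\pi_R^{\mathsf T}X^{(t)}$. **Statement.** Let $\mathcal N$ be a class of networks (of arbitrary sizes $n$) satisfying the assumptions above, and suppose that there is a constant $C_0$, independent of $n$, such that every network in $\mathcal N$ satisfies $$\frac{\max\{M_1,\tilde M_2,M_1\tilde M_2\}}{n(\pi_R^{\mathsf T}\pi_C)^2}\le C_0 .$$ Then Stochastic Push-Pull achieves linear speedup on $\mathcal N$: there is a constant $K$, the same for all networks in $\mathcal N$ (in particular independent of $n$) and all problems, such that for every network in $\mathcal N$ and all $\Delta,\sigma,L>0$ and $F_0$ there is a $T_0$ for which the following holds. For every $T\ge T_0$ the stepsize $\gamma=\sqrt{\Delta/(Q\sigma^2L(T+1))}$ is positive, and for every dimension $p$, every problem as above and every initial point with $f(x^{(0)})-\inf f\le\Delta$ and $\frac1n\sum_i\|\nabla f_i(x^{(0)})\|^2\le F_0$, the expectations below are finite and $$\frac1{T+1}\sum_{t=0}^{T}\mathbb E\,\|\nabla f(\hat x^{(t)})\|^2\le K\sqrt{\frac{\Delta\,\sigma^2L}{n(T+1)}} .$$ -/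

import Mathlib

open MeasureTheory ProbabilityTheory
open scoped Matrix

noncomputable section

namespace PushPull

/-! ### Graphs and weight matrices -/

/-- `pa` is the parent map of a rooted tree on the node set `Fin n` with root `r`: the root is the
only node without a proper parent, and following parents from any node leads to the root. -/
def IsRootedTree {n : ℕ} (pa : Fin n → Fin n) (r : Fin n) : Prop :=
  pa r = r ∧ ∀ i, ∃ k : ℕ, pa^[k] i = r

/-- The induced graph of a nonnegative matrix `A` has the edge `(i, j)` iff `A j i > 0`. -/
def Edge {n : ℕ} (A : Matrix (Fin n) (Fin n) ℝ) (i j : Fin n) : Prop := 0 < A j i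

/-- The set of roots of all spanning trees of the induced graph of `A` (tree edges go from a parent
to its child). -/
def roots {n : ℕ} (A : Matrix (Fin n) (Fin n) ℝ) : Set (Fin n) :=
  {r | ∃ pa : Fin n → Fin n, IsRootedTree pa r ∧ ∀ i, i ≠ r → Edge A (pa i) i}

/-- Nonnegative matrix all of whose rows sum to one. -/
def IsRowStochastic {n : ℕ} (A : Matrix (Fin n) (Fin n) ℝ) : Prop :=
  (∀ i j, 0 ≤ A i j) ∧ ∀ i, ∑ j, A i j = 1

/-- Root eigenvector: a nonnegative left eigenvector for the eigenvalue `1`, with `ℓ¹` norm one,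
that vanishes at the nodes that are not roots. -/
def IsRootEigenvector {n : ℕ} (A : Matrix (Fin n) (Fin n) ℝ) (v : Fin n → ℝ) : Prop :=
  v ᵥ* A = v ∧ (∀ i, 0 ≤ v i) ∧ ∑ i, v i = 1 ∧ ∀ i, i ∉ roots A → v i = 0

/-- The spectral norm of a matrix (operator norm for the Euclidean norm). -/
def specNorm {n : ℕ} (A : Matrix (Fin n) (Fin n) ℝ) : ℝ :=
  ‖Matrix.toEuclideanCLM (n := Fin n) (𝕜 := ℝ) A‖

/-- The Euclidean norm of a vector. -/
def eucNorm {n : ℕ} (v : Fin n → ℝ) : ℝ := ‖WithLp.toLp 2 v‖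

/-- `A` is exponentially decaying: `‖A ^ t - 𝟙 πᵀ‖₂ ≤ α ^ t` for all `t ≥ m`, for some
`α ∈ (0, 1)`, some integer `m > 0` and some root eigenvector `π`. -/
def ExponentiallyDecaying {n : ℕ} (A : Matrix (Fin n) (Fin n) ℝ) : Prop :=
  ∃ α : ℝ, 0 < α ∧ α < 1 ∧ ∃ m : ℕ, 0 < m ∧ ∃ v : Fin n → ℝ, IsRootEigenvector A v ∧
    ∀ t : ℕ, m ≤ t → specNorm (A ^ t - Matrix.vecMulVec (fun _ => (1 : ℝ)) v) ≤ α ^ t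

/-- The root eigenvector of `A` (it is unique for the matrices considered below). -/
def rootEigenvector {n : ℕ} (A : Matrix (Fin n) (Fin n) ℝ) : Fin n → ℝ :=
  Classical.epsilon (IsRootEigenvector A)

/-- `A` is the `0`-`1` matrix of a spanning tree with root `r`: each node gives weight one to its
parent, and the root gives weight one to itself. -/
def IsTreeMatrix {n : ℕ} (A : Matrix (Fin n) (Fin n) ℝ) (r : Fin n) : Prop :=
  ∃ pa : Fin n → Fin n, IsRootedTree pa r ∧ ∀ i j, A i j = if j = pa i then 1 else 0

/-- A network: the number of agents, the pull matrix `R` and the push matrix `C`. -/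
structure Network where
  n : ℕ
  R : Matrix (Fin n) (Fin n) ℝ
  C : Matrix (Fin n) (Fin n) ℝ

namespace Network

/-- Some spanning tree of the graph of `R` and some spanning tree of the graph of `Cᵀ` have a
common root. -/
def CommonRoot (N : Network) : Prop := (roots N.R ∩ roots N.Cᵀ).Nonempty

/-- `R` is row-stochastic, `C` is column-stochastic, `R` and `Cᵀ` are exponentially decaying. -/
def AdmissibleWeights (N : Network) : Prop :=
  IsRowStochastic N.R ∧ IsRowStochastic N.Cᵀ ∧
    ExponentiallyDecaying N.R ∧ ExponentiallyDecaying N.Cᵀ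

/-- The root eigenvector of `R`. -/
def piR (N : Network) : Fin N.n → ℝ := rootEigenvector N.R

/-- The root eigenvector of `Cᵀ`. -/
def piC (N : Network) : Fin N.n → ℝ := rootEigenvector N.Cᵀ

/-- `M₁ = ‖π_Rᵀ C‖² + ∑_{t ≥ 1} ‖π_Rᵀ (C ^ (t + 1) - C ^ t)‖²`. -/
def M1 (N : Network) : ℝ :=
  eucNorm (N.piR ᵥ* N.C) ^ 2 +
    ∑' t : ℕ, eucNorm (N.piR ᵥ* (N.C ^ (t + 2) - N.C ^ (t + 1))) ^ 2

/-- `M₂ = ∑_{t ≥ 1} t ‖π_Rᵀ (C ^ (t + 1) - C ^ t)‖`. -/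
def M2 (N : Network) : ℝ :=
  ∑' t : ℕ, ((t : ℝ) + 1) * eucNorm (N.piR ᵥ* (N.C ^ (t + 2) - N.C ^ (t + 1)))

/-- `R` and `Cᵀ` are the `0`-`1` matrices of two spanning trees with a common root. -/
def IsTreePair (N : Network) : Prop := ∃ r, IsTreeMatrix N.R r ∧ IsTreeMatrix N.Cᵀ r

open Classical in
/-- `M̃₂`: zero for a pair of spanning trees with a common root, and `M₂` otherwise. -/
def M2tilde (N : Network) : ℝ := if N.IsTreePair then 0 else N.M2

/-- `Q = max {M₁, M̃₂, M₁ M̃₂}`. -/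
def Q (N : Network) : ℝ := max N.M1 (max N.M2tilde (N.M1 * N.M2tilde))

end Network

/-! ### The stochastic optimization problem -/

/-- The decision space `ℝᵖ` with its Euclidean norm. -/
abbrev Dec (p : ℕ) : Type := EuclideanSpace ℝ (Fin p)

universe u v

/-- The data of the `n` agents: sample spaces `S i` with the local distributions `D i`, the local
objectives `f i` and the stochastic gradients `g i`. -/
structure Problem (n p : ℕ) where
  S : Fin n → Type u
  mS : ∀ i, MeasurableSpace (S i)
  D : ∀ i, Measure (S i)
  f : Fin n → Dec p → ℝ
  g : ∀ i, Dec p → S i → Dec p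

attribute [instance] Problem.mS

namespace Problem

variable {n p : ℕ}

/-- The global objective `f = (1 / n) ∑ f_i`. -/
def obj (P : Problem.{u} n p) (x : Dec p) : ℝ := (1 / (n : ℝ)) * ∑ i, P.f i x

/-- The stochastic gradients are unbiased, with variance at most `σ²`. -/
structure NoisyGradients (P : Problem.{u} n p) (σ : ℝ) : Prop where
  prob : ∀ i, IsProbabilityMeasure (P.D i)
  meas : ∀ i, Measurable (fun q : Dec p × P.S i => P.g i q.1 q.2)
  integrable : ∀ i x, Integrable (P.g i x) (P.D i)
  unbiased : ∀ i x, ∫ s, P.g i x s ∂(P.D i) = gradient (P.f i) x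
  integrable_sq : ∀ i x, Integrable (fun s => ‖P.g i x s - gradient (P.f i) x‖ ^ 2) (P.D i)
  variance_le : ∀ i x, ∫ s, ‖P.g i x s - gradient (P.f i) x‖ ^ 2 ∂(P.D i) ≤ σ ^ 2

/-- Every local objective is bounded below and has an `L`-Lipschitz gradient. -/
structure Smooth (P : Problem.{u} n p) (L : ℝ) : Prop where
  differentiable : ∀ i, Differentiable ℝ (P.f i)
  bddBelow : ∀ i, BddBelow (Set.range (P.f i))
  lipschitz : ∀ i x y, ‖gradient (P.f i) x - gradient (P.f i) y‖ ≤ L * ‖x - y‖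

/-- The samples `ξ_i⁽ᵗ⁾` have law `D i` and are independent over all agents and iterations. -/
structure IsSampling (P : Problem.{u} n p) {Ω : Type v} [MeasurableSpace Ω] (μ : Measure Ω)
    (ξ : ℕ → ∀ i, Ω → P.S i) : Prop where
  meas : ∀ t i, Measurable (ξ t i)
  law : ∀ t i, μ.map (ξ t i) = P.D i
  indep : iIndepFun (fun q : ℕ × Fin n => ξ q.1 q.2) μ

/-- The iterates `(X⁽ᵗ⁾, Y⁽ᵗ⁾)` of Stochastic Push-Pull with constant stepsize `γ`, common initial
point `x0` and realized samples `s`: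
`X⁽ᵗ⁺¹⁾ = R (X⁽ᵗ⁾ - γ Y⁽ᵗ⁾)` and `Y⁽ᵗ⁺¹⁾ = C (Y⁽ᵗ⁾ + G⁽ᵗ⁺¹⁾ - G⁽ᵗ⁾)`, with `Y⁽⁰⁾ = G⁽⁰⁾`. -/
def iterate (P : Problem.{u} n p) (R C : Matrix (Fin n) (Fin n) ℝ) (γ : ℝ) (x0 : Dec p)
    (s : ℕ → ∀ i, P.S i) : ℕ → (Fin n → Dec p) × (Fin n → Dec p)
  | 0 => (fun _ => x0, fun i => P.g i x0 (s 0 i))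
  | t + 1 =>
    let X := (iterate P R C γ x0 s t).1
    let Y := (iterate P R C γ x0 s t).2
    let X' : Fin n → Dec p := fun i => ∑ j, R i j • (X j - γ • Y j)
    (X', fun i => ∑ j, C i j • (Y j + P.g j (X' j) (s (t + 1) j) - P.g j (X j) (s t j)))

end Problem

/-- The output `x̂⁽ᵗ⁾ = π_Rᵀ X⁽ᵗ⁾` of Stochastic Push-Pull on the network `N`. -/
def output (N : Network) {p : ℕ} (P : Problem.{u} N.n p) (γ : ℝ) (x0 : Dec p)
    (s : ℕ → ∀ i, P.S i) (t : ℕ) : Dec p :=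
  ∑ i, N.piR i • (P.iterate N.R N.C γ x0 s t).1 i

/-! ### Linear speedup -/

/-- Stochastic Push-Pull with the stepsize rule `γ` (which may use the network, `Δ`, `σ`, `L` and
the horizon `T`) achieves linear speedup over the class `𝒩` of networks: there is one constant `K`,
the same for all networks of the class (hence independent of `n`) and for all problems, such that
after a transient time `T₀`, determined by the network and the problem parameters, the averaged
expected squared gradient norm is at most `K √(Δ σ² L / (n (T + 1)))`, the rate of centralized
stochastic gradient descent with `n` samples per iteration.

Here `Δ` bounds `f(x⁽⁰⁾) - inf f`, and `F₀` bounds `(1 / n) ∑ ‖∇f_i(x⁽⁰⁾)‖²`. -/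
def LinearSpeedup (𝒩 : Set Network) (γ : Network → ℝ → ℝ → ℝ → ℕ → ℝ) : Prop :=
  ∃ K : ℝ, ∀ N ∈ 𝒩, ∀ Δ σ L F₀ : ℝ, 0 < Δ → 0 < σ → 0 < L →
    ∃ T₀ : ℕ, ∀ T : ℕ, T₀ ≤ T →
      0 < γ N Δ σ L T ∧
      ∀ (p : ℕ) (P : Problem.{u} N.n p) (x0 : Dec p),
        P.NoisyGradients σ → P.Smooth L →
        P.obj x0 - (⨅ x, P.obj x) ≤ Δ →
        (1 / (N.n : ℝ)) * ∑ i, ‖gradient (P.f i) x0‖ ^ 2 ≤ F₀ →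
        ∀ (Ω : Type v) (_ : MeasurableSpace Ω) (μ : Measure Ω), IsProbabilityMeasure μ →
        ∀ ξ : ℕ → ∀ i, Ω → P.S i, P.IsSampling μ ξ →
          (∀ t ≤ T, Integrable (fun ω => ‖gradient P.obj
              (output N P (γ N Δ σ L T) x0 (fun k i => ξ k i ω) t)‖ ^ 2) μ) ∧
          (1 / ((T : ℝ) + 1)) * ∑ t ∈ Finset.range (T + 1),
              ∫ ω, ‖gradient P.obj
                (output N P (γ N Δ σ L T) x0 (fun k i => ξ k i ω) t)‖ ^ 2 ∂μ
            ≤ K * √(Δ * σ ^ 2 * L / ((N.n : ℝ) * ((T : ℝ) + 1)))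

/-- The constant stepsize `√(Δ / (Q σ² L (T + 1)))`. -/
def stepsize (N : Network) (Δ σ L : ℝ) (T : ℕ) : ℝ :=
  √(Δ / (N.Q * σ ^ 2 * L * ((T : ℝ) + 1)))

end PushPull

end

/-!
The convergence of Push-Pull is measured on a virtual iterate instead of the output
`x̂ = π_Rᵀ X`. A noise vector `e` produced at time `k` enters the output gradually, with weights
`π_Rᵀ Cᵗ` that converge geometrically to `c 𝟙ᵀ`, where `c = π_Rᵀ π_C` (`overlap`). The virtual
iterate `virt` receives it at once with the limiting weight. It differs from the output by the
stepsize times pending noise of bounded variance, and it moves by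

`z (t + 1) = z t - γ (meanDir t + c ∑ᵢ eᵢ t)`,

where `meanDir`, the noiseless tracking variable seen by the output, is close to `c n ∇f(z t)`. The
noise in this recursion has mean zero given the past, so there are no correlations with delayed
samples to estimate. The smoothness of `f` then gives, with `a = c n`,

`∑ₜ E ‖∇f‖² ≲ Δ / (γ a) + γ L c σ² (T + 1) + higher order`.

The error terms are the spread of the agents around the output, the tracking error of the
noiseless gradients and the pending noise. Each solves a linear recursion whose matrix is `R` or
`C` minus its rank-one limit, hence has geometrically decaying powers (`exists_isGain`). Since the
tracking errors are driven by increments of gradients, the errors are bounded pathwise by a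
network-dependent constant times `‖∇fᵢ(x0)‖² + γ² (∑ₜ ‖e‖² + ∑ₜ ‖∇f‖²)`
(`exists_pathwise_bound`). Expectations are taken afterwards (`exists_expected_bound`), with the
moments of the noise computed by Fubini. For the prescribed stepsize `γ² (T + 1)` does not depend
on `T`, so that after averaging the higher-order terms are of size `1 / (T + 1)` and drop below the
rate for large `T`.

The two leading terms are of the order of `√(Q / (n c²))` and `√(n c² / Q)` times the rate
(`stepsize_balance`). The first factor is bounded by assumption. The second is bounded because
`n c² ≤ 3 Q` (`n_mul_overlap_sq_le_Q`): the limit `c 𝟙` of the weights has squared norm `n c²`, and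
expanding this square along the increments yields at most `M₁ + 2 √M₁ M₂`. For two spanning trees
with a common root, where `M₂` is not available, all weights are integers, so increments are at
most their squares and `n c² ≤ n c ≤ M₁`. Positivity of `c` comes from the common root, at which
both root eigenvectors are positive.
-/

open MeasureTheory ProbabilityTheory
open scoped Matrix

noncomputable section

namespace PushPull

universe u v

/-! ### Powers of exponentially decaying weight matrices -/

lemma abs_entry_le_specNorm {n : ℕ} (A : Matrix (Fin n) (Fin n) ℝ) (i j : Fin n) :
    |A i j| ≤ specNorm A := by
  have h1 : (Matrix.toEuclideanCLM (n := Fin n) (𝕜 := ℝ) A (EuclideanSpace.single j 1)) i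
      = A i j := by
    simp [EuclideanSpace.single]
  have h2 := (Matrix.toEuclideanCLM (n := Fin n) (𝕜 := ℝ) A).le_opNorm (EuclideanSpace.single j 1)
  have h3 := PiLp.norm_apply_le
    (Matrix.toEuclideanCLM (n := Fin n) (𝕜 := ℝ) A (EuclideanSpace.single j 1)) i
  rw [h1, Real.norm_eq_abs] at h3
  simpa [specNorm] using h3.trans h2

/-- Entrywise form of exponential decay, with a constant that makes it valid for all exponents. -/
lemma exists_geometric_bound {n : ℕ} {A : Matrix (Fin n) (Fin n) ℝ} {v : Fin n → ℝ} {α : ℝ}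
    (hα : 0 < α) {m : ℕ}
    (h : ∀ t : ℕ, m ≤ t → specNorm (A ^ t - Matrix.vecMulVec (fun _ => (1 : ℝ)) v) ≤ α ^ t) :
    ∃ D : ℝ, 0 ≤ D ∧ ∀ t i j, |(A ^ t) i j - v j| ≤ D * α ^ t := by
  refine ⟨1 + ∑ t ∈ Finset.range m, ∑ i, ∑ j, |(A ^ t) i j - v j| / α ^ t, by positivity, ?_⟩
  intro t i j
  have hpos : 0 ≤ ∑ t ∈ Finset.range m, ∑ i, ∑ j, |(A ^ t) i j - v j| / α ^ t := by positivity
  rcases le_or_gt m t with hmt | hmt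
  · have h1 := (abs_entry_le_specNorm _ i j).trans (h t hmt)
    simp only [Matrix.sub_apply, Matrix.vecMulVec_apply, one_mul] at h1
    have : 0 ≤ α ^ t := by positivity
    nlinarith
  · have hp : 0 < α ^ t := by positivity
    rw [← div_le_iff₀ hp]
    have h1 : |(A ^ t) i j - v j| / α ^ t ≤ ∑ j, |(A ^ t) i j - v j| / α ^ t :=
      Finset.single_le_sum (f := fun j => |(A ^ t) i j - v j| / α ^ t)
        (fun j _ => by positivity) (Finset.mem_univ j)
    have h2 : ∑ j, |(A ^ t) i j - v j| / α ^ t ≤ ∑ i, ∑ j, |(A ^ t) i j - v j| / α ^ t :=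
      Finset.single_le_sum (f := fun i => ∑ j, |(A ^ t) i j - v j| / α ^ t)
        (fun j _ => by positivity) (Finset.mem_univ i)
    have h3 : ∑ i, ∑ j, |(A ^ t) i j - v j| / α ^ t ≤
        ∑ t ∈ Finset.range m, ∑ i, ∑ j, |(A ^ t) i j - v j| / α ^ t :=
      Finset.single_le_sum (f := fun t => ∑ i, ∑ j, |(A ^ t) i j - v j| / α ^ t)
        (fun j _ => by positivity) (Finset.mem_range.2 hmt)
    linarith

lemma vecMul_pow_eq {n : ℕ} {A : Matrix (Fin n) (Fin n) ℝ} {u : Fin n → ℝ} (hu : u ᵥ* A = u)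
    (t : ℕ) : u ᵥ* A ^ t = u := by
  induction t with
  | zero => simp
  | succ t ih => rw [pow_succ, ← Matrix.vecMul_vecMul, ih, hu]

/-- If the powers of `A` converge to `𝟙 vᵀ`, then `u Aᵗ` converges to `(∑ i, u i) v`. -/
lemma tendsto_vecMul_pow {n : ℕ} {A : Matrix (Fin n) (Fin n) ℝ} {v : Fin n → ℝ} {D ρ : ℝ}
    (h0 : 0 ≤ ρ) (h1 : ρ < 1) (h : ∀ t i j, |(A ^ t) i j - v j| ≤ D * ρ ^ t) (u : Fin n → ℝ)
    (j : Fin n) :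
    Filter.Tendsto (fun t => (u ᵥ* A ^ t) j) Filter.atTop (nhds ((∑ i, u i) * v j)) := by
  have hA : ∀ i, Filter.Tendsto (fun t => (A ^ t) i j) Filter.atTop (nhds (v j)) := by
    intro i
    rw [tendsto_iff_norm_sub_tendsto_zero]
    refine squeeze_zero (fun _ => norm_nonneg _) (fun t => h t i j) ?_
    simpa using (tendsto_pow_atTop_nhds_zero_of_lt_one h0 h1).const_mul D
  simp only [Matrix.vecMul, dotProduct, Finset.sum_mul]
  exact tendsto_finsetSum _ fun i _ => (hA i).const_mul _

/-- The limit of the powers is the only left fixed vector of total mass one; in particular, root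
eigenvectors are unique. -/
lemma eq_of_vecMul_eq {n : ℕ} {A : Matrix (Fin n) (Fin n) ℝ} {v : Fin n → ℝ} {D ρ : ℝ}
    (h0 : 0 ≤ ρ) (h1 : ρ < 1) (h : ∀ t i j, |(A ^ t) i j - v j| ≤ D * ρ ^ t) {u : Fin n → ℝ}
    (hu : u ᵥ* A = u) (hs : ∑ i, u i = 1) : u = v := by
  funext j
  have := tendsto_vecMul_pow h0 h1 h u j
  simp only [vecMul_pow_eq hu, hs, one_mul] at this
  exact tendsto_nhds_unique tendsto_const_nhds this

/-- Over an exponentially decaying matrix, the chosen root eigenvector is a root eigenvector and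
the powers of the matrix converge geometrically to it. -/
lemma ExponentiallyDecaying.rootEigenvector_spec {n : ℕ} {A : Matrix (Fin n) (Fin n) ℝ}
    (hA : ExponentiallyDecaying A) :
    IsRootEigenvector A (rootEigenvector A) ∧ ∃ D ρ : ℝ, 0 ≤ D ∧ 0 < ρ ∧ ρ < 1 ∧
      ∀ t i j, |(A ^ t) i j - rootEigenvector A j| ≤ D * ρ ^ t := by
  obtain ⟨α, h0, h1, m, -, v, hv, h⟩ := hA
  have hr : IsRootEigenvector A (rootEigenvector A) := Classical.epsilon_spec ⟨v, hv⟩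
  obtain ⟨D, hD, hb⟩ := exists_geometric_bound h0 h
  have he := eq_of_vecMul_eq h0.le h1 hb hr.1 hr.2.2.1
  exact ⟨hr, D, α, hD, h0, h1, by rwa [he]⟩

/-- A root eigenvector is positive at every root: positivity at a node passes to its parent, hence
to the root of the tree. -/
lemma IsRootEigenvector.pos_of_mem_roots {n : ℕ} {A : Matrix (Fin n) (Fin n) ℝ} {v : Fin n → ℝ}
    (hA : ∀ i j, 0 ≤ A i j) (hv : IsRootEigenvector A v) {r : Fin n} (hr : r ∈ roots A) :
    0 < v r := by
  obtain ⟨pa, ⟨hpr, htree⟩, hedge⟩ := hr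
  have hstep : ∀ i, 0 < v i → 0 < v (pa i) := by
    intro i hi
    by_cases hir : i = r
    · rw [hir, hpr, ← hir]; exact hi
    have h1 : v i * A i (pa i) ≤ ∑ k, v k * A k (pa i) :=
      Finset.single_le_sum (f := fun k => v k * A k (pa i))
        (fun k _ => mul_nonneg (hv.2.1 k) (hA k _)) (Finset.mem_univ i)
    have h2 : ∑ k, v k * A k (pa i) = v (pa i) := by
      have := congrFun hv.1 (pa i)
      simpa [Matrix.vecMul, dotProduct] using this
    have h3 : 0 < v i * A i (pa i) := mul_pos hi (hedge i hir)
    linarith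
  obtain ⟨i, hi⟩ : ∃ i, 0 < v i := by
    by_contra! hcon
    have := Finset.sum_nonpos (fun i (_ : i ∈ Finset.univ) => hcon i)
    linarith [hv.2.2.1]
  have hit : ∀ k, 0 < v (pa^[k] i) := by
    intro k
    induction k with
    | zero => simpa using hi
    | succ k ih => rw [Function.iterate_succ_apply']; exact hstep _ ih
  obtain ⟨k, hk⟩ := htree i
  exact hk ▸ hit k

/-! ### The constants of a network -/

lemma eucNorm_sq {n : ℕ} (v : Fin n → ℝ) : eucNorm v ^ 2 = ∑ i, v i ^ 2 := by
  simp [eucNorm, EuclideanSpace.norm_sq_eq]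

lemma eucNorm_nonneg {n : ℕ} (v : Fin n → ℝ) : 0 ≤ eucNorm v := norm_nonneg _

lemma eucNorm_add_le {n : ℕ} (v w : Fin n → ℝ) : eucNorm (v + w) ≤ eucNorm v + eucNorm w := by
  simpa [eucNorm] using norm_add_le (WithLp.toLp 2 v) (WithLp.toLp 2 w)

namespace Network

variable {N : Network}

/-- The overlap `c = π_Rᵀ π_C`: the common limit of all entries of `π_Rᵀ Cᵗ`, that is, the weight
with which each gradient eventually enters the output. -/
def overlap (N : Network) : ℝ := N.piR ⬝ᵥ N.piC

lemma piR_spec (hw : N.AdmissibleWeights) : IsRootEigenvector N.R N.piR :=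
  hw.2.2.1.rootEigenvector_spec.1

lemma piC_spec (hw : N.AdmissibleWeights) : IsRootEigenvector N.Cᵀ N.piC :=
  hw.2.2.2.rootEigenvector_spec.1

lemma overlap_nonneg (hw : N.AdmissibleWeights) : 0 ≤ N.overlap :=
  dotProduct_nonneg_of_nonneg (piR_spec hw).2.1 (piC_spec hw).2.1

lemma overlap_pos (hg : N.CommonRoot) (hw : N.AdmissibleWeights) : 0 < N.overlap := by
  obtain ⟨r, hrR, hrC⟩ := hg
  have h1 := piR_spec hw
  have h2 := piC_spec hw
  refine Finset.sum_pos' (fun i _ => mul_nonneg (h1.2.1 i) (h2.2.1 i)) ⟨r, Finset.mem_univ _, ?_⟩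
  exact mul_pos (h1.pos_of_mem_roots hw.1.1 hrR) (h2.pos_of_mem_roots hw.2.1.1 hrC)

lemma n_pos (hg : N.CommonRoot) : 0 < N.n := by
  obtain ⟨r, -⟩ := hg
  exact r.pos

lemma overlap_le_one (hw : N.AdmissibleWeights) : N.overlap ≤ 1 := by
  have h1 := piR_spec hw
  have h2 := piC_spec hw
  have h3 : ∀ i, N.piC i ≤ 1 := fun i => by
    rw [← h2.2.2.1]
    exact Finset.single_le_sum (fun k _ => h2.2.1 k) (Finset.mem_univ i)
  calc N.overlap = ∑ i, N.piR i * N.piC i := rfl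
    _ ≤ ∑ i, N.piR i := Finset.sum_le_sum fun i _ => mul_le_of_le_one_right (h1.2.1 i) (h3 i)
    _ = 1 := h1.2.2.1

/-- The weights `π_Rᵀ Cᵗ` with which the gradients have entered the output after `t` steps. -/
def weight (N : Network) (t : ℕ) : Fin N.n → ℝ := N.piR ᵥ* N.C ^ t

/-- The increments `π_Rᵀ (C ^ (t + 2) - C ^ (t + 1))` of `weight`, indexed as in `M1` and `M2`. -/
def weightStep (N : Network) (t : ℕ) : Fin N.n → ℝ := N.piR ᵥ* (N.C ^ (t + 2) - N.C ^ (t + 1))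

lemma weight_add_two (t : ℕ) : N.weight (t + 2) = N.weight (t + 1) + N.weightStep t := by
  simp [weight, weightStep, Matrix.vecMul_sub]

lemma exists_abs_weight_sub_le (hw : N.AdmissibleWeights) :
    ∃ D ρ : ℝ, 0 ≤ D ∧ 0 < ρ ∧ ρ < 1 ∧ ∀ t j, |N.weight t j - N.overlap| ≤ D * ρ ^ t := by
  have h1 := piR_spec hw
  obtain ⟨h2, D, ρ, hD, hρ, hρ1, hb⟩ := hw.2.2.2.rootEigenvector_spec
  refine ⟨D, ρ, hD, hρ, hρ1, fun t j => ?_⟩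
  have hb' : ∀ i, |(N.C ^ t) i j - N.piC i| ≤ D * ρ ^ t := fun i => by
    have := hb t j i
    rwa [← Matrix.transpose_pow] at this
  have : N.weight t j - N.overlap = ∑ i, N.piR i * ((N.C ^ t) i j - N.piC i) := by
    simp [weight, overlap, Matrix.vecMul, dotProduct, mul_sub]
  rw [this]
  calc |∑ i, N.piR i * ((N.C ^ t) i j - N.piC i)|
      ≤ ∑ i, N.piR i * (D * ρ ^ t) := by
        refine (Finset.abs_sum_le_sum_abs _ _).trans (Finset.sum_le_sum fun i _ => ?_)
        rw [abs_mul, abs_of_nonneg (h1.2.1 i)]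
        exact mul_le_mul_of_nonneg_left (hb' i) (h1.2.1 i)
    _ = D * ρ ^ t := by rw [← Finset.sum_mul, h1.2.2.1, one_mul]

lemma exists_eucNorm_weightStep_le (hw : N.AdmissibleWeights) :
    ∃ D ρ : ℝ, 0 ≤ D ∧ 0 < ρ ∧ ρ < 1 ∧ ∀ t, eucNorm (N.weightStep t) ≤ D * ρ ^ t := by
  obtain ⟨D, ρ, hD, hρ, hρ1, hb⟩ := exists_abs_weight_sub_le hw
  refine ⟨2 * D * (N.n + 1), ρ, by positivity, hρ, hρ1, fun t => ?_⟩
  have h1 : ∀ j, |N.weightStep t j| ≤ 2 * D * ρ ^ t := fun j => by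
    have e : N.weightStep t j =
        (N.weight (t + 2) j - N.overlap) - (N.weight (t + 1) j - N.overlap) := by
      rw [weight_add_two]; simp
    have p1 : ρ ^ (t + 1) ≤ ρ ^ t := pow_le_pow_of_le_one hρ.le hρ1.le (by omega)
    have p2 : ρ ^ (t + 2) ≤ ρ ^ t := pow_le_pow_of_le_one hρ.le hρ1.le (by omega)
    rw [e]
    have := abs_sub (N.weight (t + 2) j - N.overlap) (N.weight (t + 1) j - N.overlap)
    have := hb (t + 2) j
    have := hb (t + 1) j
    nlinarith
  have hp : 0 ≤ ρ ^ t := by positivity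
  refine abs_le_of_sq_le_sq' ?_ (by positivity) |>.2
  rw [eucNorm_sq]
  calc ∑ i, N.weightStep t i ^ 2 ≤ ∑ i : Fin N.n, (2 * D * ρ ^ t) ^ 2 :=
        Finset.sum_le_sum fun i _ => sq_le_sq' (abs_le.1 (h1 i)).1 (abs_le.1 (h1 i)).2
    _ = N.n * (2 * D * ρ ^ t) ^ 2 := by simp
    _ ≤ ((N.n : ℝ) + 1) ^ 2 * (2 * D * ρ ^ t) ^ 2 := by
        gcongr; nlinarith [(Nat.cast_nonneg N.n : (0 : ℝ) ≤ N.n)]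
    _ = _ := by ring

lemma summable_M1 (hw : N.AdmissibleWeights) :
    Summable fun t => eucNorm (N.weightStep t) ^ 2 := by
  obtain ⟨D, ρ, hD, hρ, hρ1, hb⟩ := exists_eucNorm_weightStep_le hw
  refine Summable.of_nonneg_of_le (fun t => by positivity)
    (fun t => pow_le_pow_left₀ (eucNorm_nonneg _) (hb t) 2) ?_
  have : Summable fun t : ℕ => D ^ 2 * (ρ ^ 2) ^ t :=
    (summable_geometric_of_lt_one (by positivity) (by nlinarith)).mul_left _
  exact this.congr fun t => by ring

lemma summable_M2 (hw : N.AdmissibleWeights) :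
    Summable fun t : ℕ => ((t : ℝ) + 1) * eucNorm (N.weightStep t) := by
  obtain ⟨D, ρ, hD, hρ, hρ1, hb⟩ := exists_eucNorm_weightStep_le hw
  refine Summable.of_nonneg_of_le (fun t => mul_nonneg (by positivity) (eucNorm_nonneg _))
    (fun t => mul_le_mul_of_nonneg_left (hb t) (by positivity)) ?_
  have h1 : Summable fun t : ℕ => (t : ℝ) ^ 1 * ρ ^ t :=
    summable_pow_mul_geometric_of_norm_lt_one 1 (by rwa [Real.norm_of_nonneg hρ.le])
  have h2 : Summable fun t : ℕ => ρ ^ t := summable_geometric_of_lt_one hρ.le hρ1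
  exact ((h1.add h2).mul_left D).congr fun t => by ring

lemma M1_eq : N.M1 = eucNorm (N.weight 1) ^ 2 + ∑' t, eucNorm (N.weightStep t) ^ 2 := by
  simp [M1, weight, weightStep]

lemma M2_eq : N.M2 = ∑' t : ℕ, ((t : ℝ) + 1) * eucNorm (N.weightStep t) := rfl

lemma partial_le_M1 (hw : N.AdmissibleWeights) (S : ℕ) :
    eucNorm (N.weight 1) ^ 2 + ∑ t ∈ Finset.range S, eucNorm (N.weightStep t) ^ 2 ≤ N.M1 := by
  rw [M1_eq]
  gcongr
  exact (summable_M1 hw).sum_le_tsum _ fun t _ => by positivity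

lemma M1_nonneg (hw : N.AdmissibleWeights) : 0 ≤ N.M1 :=
  le_trans (by positivity) (partial_le_M1 hw 0)

lemma M2_nonneg : 0 ≤ N.M2 := by
  rw [M2_eq]
  exact tsum_nonneg fun t => mul_nonneg (by positivity) (eucNorm_nonneg _)

lemma tendsto_weight (hw : N.AdmissibleWeights) (j : Fin N.n) :
    Filter.Tendsto (fun S => N.weight (S + 1) j) Filter.atTop (nhds N.overlap) := by
  obtain ⟨D, ρ, hD, hρ, hρ1, hb⟩ := exists_abs_weight_sub_le hw
  refine (Filter.tendsto_add_atTop_iff_nat (f := fun S => N.weight S j) 1).2 ?_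
  rw [tendsto_iff_norm_sub_tendsto_zero]
  refine squeeze_zero (fun _ => norm_nonneg _) (fun t => hb t j) ?_
  simpa using (tendsto_pow_atTop_nhds_zero_of_lt_one hρ.le hρ1).const_mul D

lemma eucNorm_weight_le (hw : N.AdmissibleWeights) (S : ℕ) :
    eucNorm (N.weight (S + 1)) ≤ ((S : ℝ) + 1) * √N.M1 := by
  induction S with
  | zero =>
    refine (Real.le_sqrt_of_sq_le (y := N.M1) ?_).trans_eq (by simp)
    simpa using partial_le_M1 hw 0
  | succ S ih =>
    rw [weight_add_two]
    have h1 : eucNorm (N.weightStep S) ≤ √N.M1 := by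
      refine Real.le_sqrt_of_sq_le ?_
      have := partial_le_M1 hw (S + 1)
      rw [Finset.sum_range_succ] at this
      have h2 : 0 ≤ ∑ t ∈ Finset.range S, eucNorm (N.weightStep t) ^ 2 := by positivity
      nlinarith [sq_nonneg (eucNorm (N.weight 1))]
    have := eucNorm_add_le (N.weight (S + 1)) (N.weightStep S)
    push_cast
    linarith

/-- The limit `c 𝟙` of the weights has squared norm `c² n`; expanding that square along the
increments costs only a cross term, bounded by `2 √M₁ M₂`. -/
lemma n_mul_overlap_sq_le (hw : N.AdmissibleWeights) :
    (N.n : ℝ) * N.overlap ^ 2 ≤ N.M1 + 2 * √N.M1 * N.M2 := by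
  have hb : ∀ S, eucNorm (N.weight (S + 1)) ^ 2 ≤ N.M1 + 2 * √N.M1 * N.M2 := by
    intro S
    have h1 : eucNorm (N.weight (S + 1)) ^ 2 ≤ (eucNorm (N.weight 1) ^ 2
        + ∑ t ∈ Finset.range S, eucNorm (N.weightStep t) ^ 2)
        + 2 * √N.M1 * ∑ t ∈ Finset.range S, ((t : ℝ) + 1) * eucNorm (N.weightStep t) := by
      induction S with
      | zero => simp
      | succ S ih =>
        have h2 := eucNorm_weight_le hw S
        have h3 := eucNorm_add_le (N.weight (S + 1)) (N.weightStep S)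
        have h4 := eucNorm_nonneg (N.weightStep S)
        have h5 := eucNorm_nonneg (N.weight (S + 1))
        have h6 : eucNorm (N.weight (S + 1)) * eucNorm (N.weightStep S)
          ≤ ((S : ℝ) + 1) * √N.M1 * eucNorm (N.weightStep S) := by gcongr
        have h7 := pow_le_pow_left₀ (eucNorm_nonneg _) h3 2
        rw [weight_add_two, Finset.sum_range_succ, Finset.sum_range_succ]
        nlinarith
    have h2 := partial_le_M1 hw S
    have h3 : ∑ t ∈ Finset.range S, ((t : ℝ) + 1) * eucNorm (N.weightStep t) ≤ N.M2 := by
      rw [M2_eq]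
      exact (summable_M2 hw).sum_le_tsum _ fun t _ => mul_nonneg (by positivity) (eucNorm_nonneg _)
    have h4 : 2 * √N.M1 * ∑ t ∈ Finset.range S, ((t : ℝ) + 1) * eucNorm (N.weightStep t)
      ≤ 2 * √N.M1 * N.M2 := by gcongr
    linarith
  have hlim : Filter.Tendsto (fun S => eucNorm (N.weight (S + 1)) ^ 2) Filter.atTop
      (nhds (∑ _j : Fin N.n, N.overlap ^ 2)) := by
    simp only [eucNorm_sq]
    exact tendsto_finsetSum _ fun j _ => (tendsto_weight hw j).pow 2
  have := le_of_tendsto' hlim hb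
  simpa using this

/-- For a pair of spanning trees all weights are integers, so that the increments are bounded by
their squares. -/
lemma n_mul_overlap_le_of_isTreePair (hw : N.AdmissibleWeights) (ht : N.IsTreePair) :
    (N.n : ℝ) * N.overlap ≤ N.M1 := by
  obtain ⟨r, ⟨pa, hpa, hR⟩, ⟨pa', hpa', hC⟩⟩ := ht
  obtain ⟨-, D, ρ, hD, hρ, hρ1, hb⟩ := hw.2.2.1.rootEigenvector_spec
  have hpi : Pi.single r 1 = N.piR := by
    refine eq_of_vecMul_eq hρ.le hρ1 hb ?_ (by simp)
    funext j
    simp [hR, hpa.1, Pi.single_apply]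
  -- The limit forces `π_R` to be the unit vector at the root, so all weights are integers.
  let Cz : Matrix (Fin N.n) (Fin N.n) ℤ := fun i j => if i = pa' j then 1 else 0
  have hCz : N.C = Cz.map (Int.castRingHom ℝ) := by
    ext i j
    have := hC j i
    simp only [Matrix.transpose_apply] at this
    rw [this, Matrix.map_apply]
    simp [Cz]
  have hint : ∀ t j, ∃ k : ℤ, N.weight t j = k := by
    intro t j
    refine ⟨(Cz ^ t) r j, ?_⟩
    have : N.C ^ t = (Cz ^ t).map (Int.castRingHom ℝ) := by
      rw [hCz, Matrix.map_pow]
    rw [weight, ← hpi, this]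
    simp
  have hstep : ∀ t j, N.weightStep t j ≤ N.weightStep t j ^ 2 := by
    intro t j
    obtain ⟨k, hk⟩ := hint (t + 1) j
    obtain ⟨l, hl⟩ := hint (t + 2) j
    have : N.weightStep t j = ((l - k : ℤ) : ℝ) := by
      have := congrFun (weight_add_two (N := N) t) j
      simp only [Pi.add_apply] at this
      push_cast
      linarith
    rw [this]
    exact_mod_cast Int.le_self_sq _
  have hone : ∀ j, N.weight 1 j ≤ N.weight 1 j ^ 2 := by
    intro j
    obtain ⟨k, hk⟩ := hint 1 j
    rw [hk]
    exact_mod_cast Int.le_self_sq _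
  have hbd : ∀ S, ∑ j, N.weight (S + 1) j ≤ N.M1 := by
    intro S
    refine le_trans ?_ (partial_le_M1 hw S)
    induction S with
    | zero => simpa [eucNorm_sq] using Finset.sum_le_sum fun j _ => hone j
    | succ S ih =>
      rw [weight_add_two, Finset.sum_range_succ]
      simp only [Pi.add_apply, Finset.sum_add_distrib]
      have : ∑ j, N.weightStep S j ≤ eucNorm (N.weightStep S) ^ 2 := by
        rw [eucNorm_sq]; exact Finset.sum_le_sum fun j _ => hstep S j
      linarith
  have hlim : Filter.Tendsto (fun S => ∑ j, N.weight (S + 1) j) Filter.atTop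
      (nhds (∑ _j : Fin N.n, N.overlap)) :=
    tendsto_finsetSum _ fun j _ => tendsto_weight hw j
  simpa using le_of_tendsto' hlim hbd

/-- The variance constant `c² n` of the aggregated noise is controlled by `Q`. -/
lemma n_mul_overlap_sq_le_Q (hw : N.AdmissibleWeights) :
    (N.n : ℝ) * N.overlap ^ 2 ≤ 3 * N.Q := by
  have hM1 := M1_nonneg hw
  have hM2 := M2_nonneg (N := N)
  have hQ1 : N.M1 ≤ N.Q := le_max_left _ _
  by_cases ht : N.IsTreePair
  · have h1 := n_mul_overlap_le_of_isTreePair hw ht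
    have h2 := overlap_le_one hw
    have h3 := overlap_nonneg hw
    have h4 : (N.n : ℝ) * N.overlap ^ 2 ≤ N.n * N.overlap := by
      gcongr; nlinarith
    linarith
  · have hM : N.M2tilde = N.M2 := if_neg ht
    have hQ2 : N.M2 ≤ N.Q := hM ▸ (le_max_left _ _).trans (le_max_right _ _)
    have hQ3 : N.M1 * N.M2 ≤ N.Q := hM ▸ (le_max_right _ _).trans (le_max_right _ _)
    have h1 := n_mul_overlap_sq_le hw
    have h2 : 2 * √N.M1 ≤ 1 + N.M1 := by
      nlinarith [Real.sq_sqrt hM1, sq_nonneg (√N.M1 - 1)]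
    have h3 : 2 * √N.M1 * N.M2 ≤ (1 + N.M1) * N.M2 := by gcongr
    linarith

end Network

/-! ### Matrices acting on stacked vectors -/

section Action

variable {n p : ℕ}

/-- The action of an `n × n` matrix on a stack of `n` vectors of the decision space. -/
def act (A : Matrix (Fin n) (Fin n) ℝ) : (Fin n → Dec p) →ₗ[ℝ] (Fin n → Dec p) where
  toFun X i := ∑ j, A i j • X j
  map_add' X Y := by ext1 i; simp [Finset.sum_add_distrib]
  map_smul' a X := by ext1 i; simp [Finset.smul_sum, smul_comm a]

/-- The combination of a stack of vectors with the weights `v`. -/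
def comb (v : Fin n → ℝ) : (Fin n → Dec p) →ₗ[ℝ] Dec p where
  toFun X := ∑ j, v j • X j
  map_add' X Y := by simp [Finset.sum_add_distrib]
  map_smul' a X := by simp [Finset.smul_sum, smul_comm a]

lemma act_apply (A : Matrix (Fin n) (Fin n) ℝ) (X : Fin n → Dec p) (i : Fin n) :
    act A X i = ∑ j, A i j • X j := rfl

lemma comb_apply (v : Fin n → ℝ) (X : Fin n → Dec p) : comb v X = ∑ j, v j • X j := rfl

lemma act_mul (A B : Matrix (Fin n) (Fin n) ℝ) (X : Fin n → Dec p) :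
    act (A * B) X = act A (act B X) := by
  ext1 i
  simp only [act_apply, Matrix.mul_apply, Finset.sum_smul, Finset.smul_sum, mul_smul]
  exact Finset.sum_comm

lemma act_one (X : Fin n → Dec p) : act 1 X = X := by
  ext1 i
  simp [act_apply, Matrix.one_apply]

lemma act_sub_matrix (A B : Matrix (Fin n) (Fin n) ℝ) (X : Fin n → Dec p) :
    act (A - B) X = act A X - act B X := by
  ext1 i
  simp [act_apply, sub_smul]

lemma comb_act (v : Fin n → ℝ) (A : Matrix (Fin n) (Fin n) ℝ) (X : Fin n → Dec p) :
    comb v (act A X) = comb (v ᵥ* A) X := by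
  simp only [act_apply, comb_apply, Matrix.vecMul, dotProduct, Finset.sum_smul, Finset.smul_sum,
    mul_smul]
  exact Finset.sum_comm

lemma act_vecMulVec (u v : Fin n → ℝ) (X : Fin n → Dec p) :
    act (Matrix.vecMulVec u v) X = fun i => u i • comb v X := by
  ext1 i
  simp [act_apply, comb_apply, Matrix.vecMulVec_apply, mul_smul, Finset.smul_sum]

lemma norm_act_le {A : Matrix (Fin n) (Fin n) ℝ} {κ : ℝ} (hκ : 0 ≤ κ) (hA : ∀ i j, |A i j| ≤ κ)
    (X : Fin n → Dec p) : ‖act A X‖ ≤ n * κ * ‖X‖ := by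
  refine (pi_norm_le_iff_of_nonneg (by positivity)).2 fun i => ?_
  calc ‖∑ j, A i j • X j‖ ≤ ∑ j : Fin n, κ * ‖X‖ := by
        refine (norm_sum_le _ _).trans (Finset.sum_le_sum fun j _ => ?_)
        rw [norm_smul]
        exact mul_le_mul (hA i j) (norm_le_pi_norm X j) (norm_nonneg _) hκ
    _ = n * κ * ‖X‖ := by simp [mul_assoc]

lemma norm_comb_le {v : Fin n → ℝ} (hv : ∀ i, 0 ≤ v i) (hs : ∑ i, v i = 1) (X : Fin n → Dec p) :
    ‖comb v X‖ ≤ ‖X‖ := by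
  calc ‖∑ j, v j • X j‖ ≤ ∑ j : Fin n, v j * ‖X‖ := by
        refine (norm_sum_le _ _).trans (Finset.sum_le_sum fun j _ => ?_)
        rw [norm_smul, Real.norm_of_nonneg (hv j)]
        exact mul_le_mul_of_nonneg_left (norm_le_pi_norm X j) (hv j)
    _ = ‖X‖ := by rw [← Finset.sum_mul, hs, one_mul]

lemma comb_const {v : Fin n → ℝ} (hs : ∑ i, v i = 1) (x : Dec p) :
    comb v (fun _ => x) = x := by
  rw [comb_apply, ← Finset.sum_smul, hs, one_smul]

lemma norm_sum_le_card_mul (X : Fin n → Dec p) : ‖∑ i, X i‖ ≤ n * ‖X‖ := by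
  simpa using norm_sum_le_of_le Finset.univ fun i _ => norm_le_pi_norm X i

end Action

/-! ### Stability of geometrically decaying linear recursions -/

lemma add_sq_le_weighted {θ α β : ℝ} (h1 : θ < 1) :
    θ * (α + β) ^ 2 ≤ α ^ 2 + θ / (1 - θ) * β ^ 2 := by
  have h2 : 0 < 1 - θ := by linarith
  have : α ^ 2 + θ / (1 - θ) * β ^ 2 - θ * (α + β) ^ 2 = ((1 - θ) * α - θ * β) ^ 2 / (1 - θ) := by
    field_simp
    ring
  have : 0 ≤ ((1 - θ) * α - θ * β) ^ 2 / (1 - θ) := by positivity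
  linarith

/-- The `ℓ²`-gain of a scalar contraction. The term at the final time is what the induction
needs. -/
lemma scalar_stability {θ : ℝ} (h0 : 0 < θ) (h1 : θ < 1) {α β : ℕ → ℝ}
    (hα : ∀ t, α (t + 1) = θ * (α t + β t)) (T : ℕ) :
    (1 - θ) * ∑ t ∈ Finset.range (T + 1), α t ^ 2 + θ * α T ^ 2 ≤
      α 0 ^ 2 + θ ^ 2 / (1 - θ) * ∑ t ∈ Finset.range T, β t ^ 2 := by
  induction T with
  | zero => simp; linarith
  | succ T ih =>
    rw [Finset.sum_range_succ, Finset.sum_range_succ (fun t => β t ^ 2)]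
    have h2 := mul_le_mul_of_nonneg_left (add_sq_le_weighted (α := α T) (β := β T) h1) h0.le
    have h3 : θ * (θ / (1 - θ) * β T ^ 2) = θ ^ 2 / (1 - θ) * β T ^ 2 := by ring
    have h4 : α (T + 1) ^ 2 = θ * (θ * (α T + β T) ^ 2) := by rw [hα]; ring
    linarith

/-- `K` is an `ℓ²`-gain of the recursion `a (t + 1) = P (a t + b t)`, in every dimension `p`. Stacks
carry the sup norm over the agents. -/
def IsGain {n : ℕ} (P : Matrix (Fin n) (Fin n) ℝ) (K : ℝ) : Prop :=
  ∀ (p : ℕ) (a b : ℕ → Fin n → Dec p), (∀ t, a (t + 1) = act P (a t + b t)) → ∀ T : ℕ,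
    ∑ t ∈ Finset.range (T + 1), ‖a t‖ ^ 2 ≤ K * (‖a 0‖ ^ 2 + ∑ t ∈ Finset.range T, ‖b t‖ ^ 2)

/-- Geometrically decaying powers give an `ℓ²`-gain. The norms of all `P ^ s (a t)` are dominated at
once by a scalar recursion with rate `ρ`. -/
lemma exists_isGain {n : ℕ} {P : Matrix (Fin n) (Fin n) ℝ} {D ρ : ℝ} (hD : 0 ≤ D) (h0 : 0 < ρ)
    (h1 : ρ < 1) (hP : ∀ s i j, |(P ^ s) i j| ≤ D * ρ ^ s) : ∃ K, 0 ≤ K ∧ IsGain P K := by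
  have h2 : 0 < 1 - ρ := by linarith
  refine ⟨(n * D) ^ 2 * ((1 - ρ)⁻¹ * (1 + ρ ^ 2 / (1 - ρ))), by positivity, ?_⟩
  intro p a b hab T
  -- The scalar recursion that dominates the norms.
  let α : ℕ → ℝ := fun t => Nat.rec ‖a 0‖ (fun t x => ρ * (x + ‖b t‖)) t
  have hα : ∀ t, α (t + 1) = ρ * (α t + ‖b t‖) := fun t => rfl
  have hb : ∀ s X, ‖act (p := p) (P ^ s) X‖ ≤ n * D * ρ ^ s * ‖X‖ := fun s X => by
    have := norm_act_le (by positivity) (hP s) X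
    rwa [← mul_assoc] at this
  have hdom : ∀ t s, ‖act (P ^ s) (a t)‖ ≤ n * D * ρ ^ s * α t := by
    intro t
    induction t with
    | zero => exact fun s => hb s _
    | succ t ih =>
      intro s
      rw [hab, ← act_mul, ← pow_succ, map_add, hα]
      refine (norm_add_le _ _).trans ?_
      have h3 := ih (s + 1)
      have h4 := hb (s + 1) (b t)
      rw [pow_succ ρ] at h3 h4
      linarith
  have hdom' : ∀ t, ‖a t‖ ^ 2 ≤ (n * D) ^ 2 * α t ^ 2 := by
    intro t
    have := hdom t 0
    simp only [pow_zero, act_one, mul_one] at this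
    rw [← mul_pow]
    exact pow_le_pow_left₀ (norm_nonneg _) this 2
  have hs := scalar_stability h0 h1 hα T
  have hs' : ∑ t ∈ Finset.range (T + 1), α t ^ 2 ≤
      (1 - ρ)⁻¹ * (α 0 ^ 2 + ρ ^ 2 / (1 - ρ) * ∑ t ∈ Finset.range T, ‖b t‖ ^ 2) := by
    rw [← div_eq_inv_mul, le_div_iff₀ h2]
    have : 0 ≤ ρ * α T ^ 2 := by positivity
    linarith
  have hnn : 0 ≤ ∑ t ∈ Finset.range T, ‖b t‖ ^ 2 := by positivity
  have hq : 0 ≤ ρ ^ 2 / (1 - ρ) := by positivity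
  calc ∑ t ∈ Finset.range (T + 1), ‖a t‖ ^ 2
      ≤ (n * D) ^ 2 * ∑ t ∈ Finset.range (T + 1), α t ^ 2 := by
        rw [Finset.mul_sum]; exact Finset.sum_le_sum fun t _ => hdom' t
    _ ≤ (n * D) ^ 2 * ((1 - ρ)⁻¹ *
        (‖a 0‖ ^ 2 + ρ ^ 2 / (1 - ρ) * ∑ t ∈ Finset.range T, ‖b t‖ ^ 2)) :=
        mul_le_mul_of_nonneg_left hs' (by positivity)
    _ ≤ (n * D) ^ 2 * ((1 - ρ)⁻¹ *
        ((1 + ρ ^ 2 / (1 - ρ)) * (‖a 0‖ ^ 2 + ∑ t ∈ Finset.range T, ‖b t‖ ^ 2))) := by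
        gcongr; nlinarith [sq_nonneg ‖a 0‖]
    _ = _ := by ring

/-- Subtracting the rank-one limit from a row-stochastic matrix leaves a geometrically decaying
matrix. -/
lemma exists_deviation_bound {n : ℕ} {A : Matrix (Fin n) (Fin n) ℝ} (hA : IsRowStochastic A)
    (hd : ExponentiallyDecaying A) : ∃ D ρ : ℝ, 0 ≤ D ∧ 0 < ρ ∧ ρ < 1 ∧ ∀ s i j,
      |((A - Matrix.vecMulVec (fun _ => 1) (rootEigenvector A)) ^ s : Matrix (Fin n) (Fin n) ℝ) i j|
        ≤ D * ρ ^ s := by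
  obtain ⟨hv, D, ρ, hD, h0, h1, hb⟩ := hd.rootEigenvector_spec
  set v := rootEigenvector A
  set J := Matrix.vecMulVec (fun _ => (1 : ℝ)) v
  have hvA : ∀ j, ∑ k, v k * A k j = v j := fun j => by
    simpa [Matrix.vecMul, dotProduct] using congrFun hv.1 j
  have hAJ : A * J = J := by
    ext i j; simp [J, Matrix.mul_apply, Matrix.vecMulVec_apply, ← Finset.sum_mul, hA.2 i]
  have hJA : J * A = J := by
    ext i j; simp [J, Matrix.mul_apply, Matrix.vecMulVec_apply, hvA]
  have hJJ : J * J = J := by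
    ext i j; simp [J, Matrix.mul_apply, Matrix.vecMulVec_apply, ← Finset.sum_mul, hv.2.2.1]
  have hpow : ∀ s, (A - J) ^ (s + 1) = A ^ (s + 1) - J := by
    intro s
    have hJp : ∀ s, J * A ^ s = J := fun s => by
      induction s with
      | zero => simp
      | succ s ih => rw [pow_succ, ← mul_assoc, ih, hJA]
    have hpJ : ∀ s, A ^ s * J = J := fun s => by
      induction s with
      | zero => simp
      | succ s ih => rw [pow_succ, mul_assoc, hAJ, ih]
    induction s with
    | zero => simp
    | succ s ih => rw [pow_succ, ih, sub_mul, mul_sub, mul_sub, hJA, hJJ, hpJ, ← pow_succ]; simp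
  refine ⟨D + 1, ρ, by positivity, h0, h1, fun s i j => ?_⟩
  cases s with
  | zero =>
    simp only [pow_zero, Matrix.one_apply, mul_one]
    split_ifs <;> simp <;> linarith
  | succ s =>
    rw [hpow, Matrix.sub_apply, show J i j = v j by simp [J, Matrix.vecMulVec_apply]]
    have : 0 ≤ ρ ^ (s + 1) := by positivity
    linarith [hb (s + 1) i j]

namespace Network

/-- The deviation of the pull matrix from its limit. -/
def pullDev (N : Network) : Matrix (Fin N.n) (Fin N.n) ℝ :=
  N.R - Matrix.vecMulVec (fun _ => 1) N.piR

/-- The limit `π_C 𝟙ᵀ` of the powers of the push matrix. -/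
def pushLim (N : Network) : Matrix (Fin N.n) (Fin N.n) ℝ := Matrix.vecMulVec N.piC (fun _ => 1)

/-- The deviation of the push matrix from its limit. -/
def pushDev (N : Network) : Matrix (Fin N.n) (Fin N.n) ℝ := N.C - N.pushLim

variable {N : Network} {p : ℕ}

lemma exists_isGain_pullDev (hw : N.AdmissibleWeights) : ∃ K, 0 ≤ K ∧ IsGain N.pullDev K := by
  obtain ⟨D, ρ, hD, h0, h1, hb⟩ := exists_deviation_bound hw.1 hw.2.2.1
  exact exists_isGain hD h0 h1 hb

lemma exists_isGain_pushDev (hw : N.AdmissibleWeights) : ∃ K, 0 ≤ K ∧ IsGain N.pushDev K := by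
  obtain ⟨D, ρ, hD, h0, h1, hb⟩ := exists_deviation_bound hw.2.1 hw.2.2.2
  refine exists_isGain hD h0 h1 fun s i j => ?_
  have : N.pushDev = (N.Cᵀ - Matrix.vecMulVec (fun _ => (1 : ℝ)) (rootEigenvector N.Cᵀ))ᵀ := by
    rw [Matrix.transpose_sub, Matrix.transpose_transpose, Matrix.transpose_vecMulVec]
    rfl
  rw [this, ← Matrix.transpose_pow]
  exact hb s j i

lemma act_pushLim (X : Fin N.n → Dec p) :
    act N.pushLim X = fun i => N.piC i • ∑ j, X j := by
  rw [pushLim, act_vecMulVec]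
  simp [comb_apply]

lemma sum_act_C (hw : N.AdmissibleWeights) (X : Fin N.n → Dec p) :
    ∑ i, act N.C X i = ∑ i, X i := by
  simp only [act_apply]
  rw [Finset.sum_comm]
  refine Finset.sum_congr rfl fun j _ => ?_
  rw [← Finset.sum_smul, show ∑ i, N.C i j = 1 from hw.2.1.2 j, one_smul]

lemma act_C_pushLim (hw : N.AdmissibleWeights) (X : Fin N.n → Dec p) :
    act N.C (act N.pushLim X) = act N.pushLim X := by
  rw [act_pushLim]
  ext1 i
  have := congrFun (piC_spec hw).1 i
  simp only [Matrix.vecMul, dotProduct, Matrix.transpose_apply] at this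
  simp only [act_apply, smul_smul]
  rw [← Finset.sum_smul]
  congr 1
  rw [← this]
  exact Finset.sum_congr rfl fun j _ => mul_comm _ _

lemma act_pushLim_C (hw : N.AdmissibleWeights) (X : Fin N.n → Dec p) :
    act N.pushLim (act N.C X) = act N.pushLim X := by
  simp only [act_pushLim, sum_act_C hw]

lemma sum_act_pushLim (hw : N.AdmissibleWeights) (X : Fin N.n → Dec p) :
    ∑ i, act N.pushLim X i = ∑ i, X i := by
  rw [act_pushLim, ← Finset.sum_smul, (piC_spec hw).2.2.1, one_smul]

lemma act_pushLim_pushLim (hw : N.AdmissibleWeights) (X : Fin N.n → Dec p) :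
    act N.pushLim (act N.pushLim X) = act N.pushLim X := by
  rw [act_pushLim (act N.pushLim X), sum_act_pushLim hw, act_pushLim]

lemma act_pushDev (X : Fin N.n → Dec p) :
    act N.pushDev X = act N.C X - act N.pushLim X := act_sub_matrix _ _ _

lemma comb_piR_pushLim (X : Fin N.n → Dec p) :
    comb N.piR (act N.pushLim X) = N.overlap • ∑ i, X i := by
  rw [act_pushLim, comb_apply, overlap, dotProduct, Finset.sum_smul]
  simp only [smul_smul]

lemma comb_piR_act (hw : N.AdmissibleWeights) (X : Fin N.n → Dec p) :
    comb N.piR (act N.R X) = comb N.piR X := by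
  rw [comb_act, (piR_spec hw).1]

lemma norm_act_pushLim_le (hw : N.AdmissibleWeights) (X : Fin N.n → Dec p) :
    ‖act N.pushLim X‖ ≤ ‖∑ i, X i‖ := by
  rw [act_pushLim]
  refine (pi_norm_le_iff_of_nonneg (norm_nonneg _)).2 fun i => ?_
  have h2 := piC_spec hw
  have h3 : N.piC i ≤ 1 := by
    rw [← h2.2.2.1]
    exact Finset.single_le_sum (fun k _ => h2.2.1 k) (Finset.mem_univ i)
  rw [norm_smul, Real.norm_of_nonneg (h2.2.1 i)]
  exact mul_le_of_le_one_left (norm_nonneg _) h3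

end Network

/-! ### Gradient tracking -/

namespace Network

variable {N : Network} {p : ℕ}

/-- The push recursion `Y (t + 1) = C (Y t + g (t + 1) - g t)`, `Y 0 = g 0`, driven by `g`. -/
def track (N : Network) (g : ℕ → Fin N.n → Dec p) : ℕ → Fin N.n → Dec p
  | 0 => g 0
  | t + 1 => act N.C (track N g t + (g (t + 1) - g t))

/-- The tracking error `Y t - π_C 𝟙ᵀ g t`. -/
def trackErr (N : Network) (g : ℕ → Fin N.n → Dec p) (t : ℕ) : Fin N.n → Dec p :=
  N.track g t - act N.pushLim (g t)

/-- The running sum of the tracking errors, up to a constant: see `lag_succ_sub`. -/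
def lag (N : Network) (g : ℕ → Fin N.n → Dec p) : ℕ → Fin N.n → Dec p
  | 0 => -(g 0 - act N.pushLim (g 0))
  | t + 1 => act N.pushDev (lag N g t + g t)

lemma track_add (g g' : ℕ → Fin N.n → Dec p) (t : ℕ) :
    N.track (g + g') t = N.track g t + N.track g' t := by
  induction t with
  | zero => rfl
  | succ t ih =>
    simp only [track, ih, Pi.add_apply, ← map_add]
    congr 1
    abel

lemma act_pushLim_track (hw : N.AdmissibleWeights) (g : ℕ → Fin N.n → Dec p) (t : ℕ) :
    act N.pushLim (N.track g t) = act N.pushLim (g t) := by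
  induction t with
  | zero => rfl
  | succ t ih =>
    rw [track, act_pushLim_C hw, map_add, ih, map_sub]
    abel

/-- The tracking error is driven by the increments of `g` only, so that the heterogeneity of the
local gradients enters through `g 0` alone. -/
lemma trackErr_succ (hw : N.AdmissibleWeights) (g : ℕ → Fin N.n → Dec p) (t : ℕ) :
    N.trackErr g (t + 1) = act N.pushDev (N.trackErr g t + (g (t + 1) - g t)) := by
  rw [act_pushDev]
  simp only [trackErr, track, map_add, map_sub, act_pushLim_track hw, act_pushLim_pushLim hw,
    act_C_pushLim hw]
  abel

lemma lag_succ_sub (hw : N.AdmissibleWeights) (g : ℕ → Fin N.n → Dec p) (t : ℕ) :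
    N.lag g (t + 1) - N.lag g t = N.trackErr g t := by
  induction t with
  | zero =>
    have h0 : N.lag g 0 = -(g 0 - act N.pushLim (g 0)) := rfl
    have h1 : N.lag g (0 + 1) = act N.pushDev (N.lag g 0 + g 0) := rfl
    rw [h1, h0, act_pushDev]
    simp only [trackErr, track, map_add, map_sub, map_neg, act_pushLim_pushLim hw,
      act_C_pushLim hw]
    abel
  | succ t ih =>
    rw [trackErr_succ hw, ← ih, lag, lag, ← map_sub, ← lag]
    congr 1
    abel

lemma norm_sub_pushLim_le (hw : N.AdmissibleWeights) (X : Fin N.n → Dec p) :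
    ‖X - act N.pushLim X‖ ≤ (1 + N.n) * ‖X‖ := by
  have := norm_sub_le X (act N.pushLim X)
  have := norm_act_pushLim_le hw X
  have := norm_sum_le_card_mul X
  linarith

lemma sum_trackErr_le (hw : N.AdmissibleWeights) {K : ℝ} (hK0 : 0 ≤ K) (hK : IsGain N.pushDev K)
    (g : ℕ → Fin N.n → Dec p) (T : ℕ) :
    ∑ t ∈ Finset.range (T + 1), ‖N.trackErr g t‖ ^ 2 ≤ K * ((1 + N.n) ^ 2 * ‖g 0‖ ^ 2 +
      ∑ t ∈ Finset.range T, ‖g (t + 1) - g t‖ ^ 2) := by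
  refine (hK p (N.trackErr g) (fun t => g (t + 1) - g t) (trackErr_succ hw g) T).trans ?_
  gcongr
  rw [← mul_pow]
  exact pow_le_pow_left₀ (norm_nonneg _) (norm_sub_pushLim_le hw _) 2

lemma sum_lag_le (hw : N.AdmissibleWeights) {K : ℝ} (hK0 : 0 ≤ K) (hK : IsGain N.pushDev K)
    (g : ℕ → Fin N.n → Dec p) (T : ℕ) :
    ∑ t ∈ Finset.range (T + 1), ‖N.lag g t‖ ^ 2 ≤ K * ((1 + N.n) ^ 2 * ‖g 0‖ ^ 2 +
      ∑ t ∈ Finset.range T, ‖g t‖ ^ 2) := by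
  refine (hK p (N.lag g) g (fun _ => rfl) T).trans ?_
  gcongr
  rw [← mul_pow]
  refine pow_le_pow_left₀ (norm_nonneg _) ?_ 2
  rw [lag, norm_neg]
  exact norm_sub_pushLim_le hw _

end Network

/-! ### Deterministic analysis of a realized run -/

lemma sq_add_three_le (a b c : ℝ) : (a + b + c) ^ 2 ≤ 3 * (a ^ 2 + b ^ 2 + c ^ 2) := by
  nlinarith [sq_nonneg (a - b), sq_nonneg (a - c), sq_nonneg (b - c)]

lemma sq_add_four_le (a b c d : ℝ) :
    (a + b + c + d) ^ 2 ≤ 4 * (a ^ 2 + b ^ 2 + c ^ 2 + d ^ 2) := by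
  nlinarith [sq_nonneg (a - b), sq_nonneg (a - c), sq_nonneg (b - c), sq_nonneg (a - d),
    sq_nonneg (b - d), sq_nonneg (c - d)]

/-- The stack of the local gradients `F i` at the points `X t i`. -/
def localGrad {n p : ℕ} (F : Fin n → Dec p → Dec p) (X : ℕ → Fin n → Dec p) (t : ℕ) :
    Fin n → Dec p := fun i => F i (X t i)

/-- The average of the local gradients at a common point. -/
def avgGrad {n p : ℕ} (F : Fin n → Dec p → Dec p) (x : Dec p) : Dec p :=
  (1 / (n : ℝ)) • ∑ i, F i x

/-- A realized run of Push-Pull with local gradients `F` and realized gradient noise `e`; the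
tracking variable is eliminated. -/
structure IsRun (N : Network) {p : ℕ} (L γ : ℝ) (F : Fin N.n → Dec p → Dec p) (x0 : Dec p)
    (X e : ℕ → Fin N.n → Dec p) : Prop where
  lip : ∀ i x y, ‖F i x - F i y‖ ≤ L * ‖x - y‖
  X_zero : X 0 = fun _ => x0
  X_succ : ∀ t, X (t + 1) = act N.R (X t - γ • N.track (localGrad F X + e) t)

namespace Network

variable {p : ℕ}

/-- The output `π_Rᵀ X t`. -/
def mid (N : Network) (X : ℕ → Fin N.n → Dec p) (t : ℕ) : Dec p := comb N.piR (X t)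

/-- The distance of the agents from the output. -/
def spread (N : Network) (X : ℕ → Fin N.n → Dec p) (t : ℕ) : Fin N.n → Dec p :=
  X t - fun _ => N.mid X t

/-- The correction of the output, in units of the stepsize, by the noise that is still travelling
through the network. The constant added to the lag makes the correction vanish at time `0`. -/
def pending (N : Network) (e : ℕ → Fin N.n → Dec p) (t : ℕ) : Dec p :=
  comb N.piR (N.lag e t + (e 0 - act N.pushLim (e 0)))

/-- The virtual iterate: the output, as if every noise vector entered it immediately and with its
limiting weight. -/
def virt (N : Network) (γ : ℝ) (X e : ℕ → Fin N.n → Dec p) (t : ℕ) : Dec p :=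
  N.mid X t + γ • N.pending e t

/-- The noiseless part of the update direction. -/
def meanDir (N : Network) (h : ℕ → Fin N.n → Dec p) (t : ℕ) : Dec p := comb N.piR (N.track h t)

/-- The noise of the update direction of the virtual iterate. -/
def freshNoise (N : Network) (e : ℕ → Fin N.n → Dec p) (t : ℕ) : Dec p :=
  N.overlap • ∑ i, e t i

variable {N : Network} {L γ : ℝ} {F : Fin N.n → Dec p → Dec p} {x0 : Dec p}
  {X e : ℕ → Fin N.n → Dec p}

lemma mid_succ (hw : N.AdmissibleWeights) (hr : IsRun N L γ F x0 X e) (t : ℕ) :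
    N.mid X (t + 1) = N.mid X t - γ • comb N.piR (N.track (localGrad F X + e) t) := by
  rw [mid, hr.X_succ, comb_piR_act hw, map_sub, map_smul, mid]

/-- The spread is contracted by the pull matrix and driven by the tracking variable. -/
lemma spread_succ (hw : N.AdmissibleWeights) (hr : IsRun N L γ F x0 X e) (t : ℕ) :
    N.spread X (t + 1) =
      act N.pullDev (N.spread X t + -(γ • N.track (localGrad F X + e) t)) := by
  have hconst : ∀ x : Dec p, act N.R (fun _ => x) = fun _ => x := fun x => by
    ext1 i
    rw [act_apply, ← Finset.sum_smul, hw.1.2 i, one_smul]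
  have hvec : ∀ Z : Fin N.n → Dec p,
      act (Matrix.vecMulVec (fun _ => 1) N.piR) Z = fun _ => comb N.piR Z := fun Z => by
    rw [act_vecMulVec]; simp
  rw [pullDev, act_sub_matrix, hvec]
  have h1 : comb N.piR (N.spread X t) = 0 := by
    rw [spread, map_sub, comb_const (piR_spec hw).2.2.1, mid, sub_self]
  have h2 : N.spread X (t + 1) = act N.R (X t - γ • N.track (localGrad F X + e) t) -
      fun _ => (N.mid X t - γ • comb N.piR (N.track (localGrad F X + e) t)) := by
    rw [spread, mid_succ hw hr, hr.X_succ]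
  have h3 : comb N.piR (N.spread X t + -(γ • N.track (localGrad F X + e) t)) =
      -(γ • comb N.piR (N.track (localGrad F X + e) t)) := by
    rw [map_add, h1, zero_add, map_neg, map_smul]
  rw [h2, h3, spread]
  simp only [map_add, map_sub, map_neg, map_smul, hconst]
  ext1 i
  simp only [Pi.sub_apply, Pi.add_apply, Pi.neg_apply]
  abel

lemma virt_zero (hw : N.AdmissibleWeights) (hr : IsRun N L γ F x0 X e) : N.virt γ X e 0 = x0 := by
  have h0 : N.lag e 0 = -(e 0 - act N.pushLim (e 0)) := rfl
  rw [virt, pending, h0, neg_add_cancel, map_zero, smul_zero, add_zero, mid, hr.X_zero,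
    comb_const (piR_spec hw).2.2.1]

/-- The virtual iterate receives only the noise of the current time, unlike the output. -/
lemma virt_succ (hw : N.AdmissibleWeights) (hr : IsRun N L γ F x0 X e) (t : ℕ) :
    N.virt γ X e (t + 1) =
      N.virt γ X e t - γ • (N.meanDir (localGrad F X) t + N.freshNoise e t) := by
  have h1 : N.lag e (t + 1) = N.lag e t + (N.track e t - act N.pushLim (e t)) := by
    rw [← sub_eq_iff_eq_add', lag_succ_sub hw, trackErr]
  rw [virt, virt, mid_succ hw hr, track_add, pending, pending, h1, meanDir, freshNoise,
    ← comb_piR_pushLim]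
  simp only [map_add, map_sub, smul_add, smul_sub]
  abel

lemma norm_comb_piR_le (hw : N.AdmissibleWeights) (Z : Fin N.n → Dec p) :
    ‖comb N.piR Z‖ ≤ ‖Z‖ := norm_comb_le (piR_spec hw).2.1 (piR_spec hw).2.2.1 Z

/-! #### Pointwise estimates -/

lemma norm_iterate_step_le (hw : N.AdmissibleWeights) (hγ : 0 ≤ γ) (hr : IsRun N L γ F x0 X e)
    (t : ℕ) : ‖X (t + 1) - X t‖ ≤
      ‖N.spread X (t + 1)‖ + ‖N.spread X t‖ + γ * ‖N.track (localGrad F X + e) t‖ := by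
  have h1 : X (t + 1) - X t = N.spread X (t + 1) - N.spread X t +
      fun _ => -(γ • comb N.piR (N.track (localGrad F X + e) t)) := by
    ext1 i
    simp only [spread, mid_succ hw hr, Pi.sub_apply, Pi.add_apply]
    abel
  rw [h1]
  refine (norm_add_le _ _).trans (add_le_add (norm_sub_le _ _) ?_)
  refine (pi_norm_const_le _).trans ?_
  rw [norm_neg, norm_smul, Real.norm_of_nonneg hγ]
  exact mul_le_mul_of_nonneg_left (norm_comb_piR_le hw _) hγ

lemma norm_localGrad_step_le (hL : 0 ≤ L) (hr : IsRun N L γ F x0 X e) (t : ℕ) :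
    ‖localGrad F X (t + 1) - localGrad F X t‖ ≤ L * ‖X (t + 1) - X t‖ := by
  refine (pi_norm_le_iff_of_nonneg (by positivity)).2 fun i => ?_
  refine (hr.lip i _ _).trans ?_
  gcongr
  exact norm_le_pi_norm (X (t + 1) - X t) i

lemma sum_eq_avgGrad (hn : 0 < N.n) (F : Fin N.n → Dec p → Dec p) (x : Dec p) :
    ∑ i, F i x = (N.n : ℝ) • avgGrad F x := by
  have : (N.n : ℝ) ≠ 0 := by positivity
  rw [avgGrad, smul_smul, mul_one_div_cancel this, one_smul]

lemma norm_sum_localGrad_sub_le (hL : 0 ≤ L) (hr : IsRun N L γ F x0 X e) (t : ℕ) (x : Dec p)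
    {δ : ℝ} (hδ : ∀ i, ‖X t i - x‖ ≤ δ) :
    ‖∑ i, localGrad F X t i - ∑ i, F i x‖ ≤ N.n * (L * δ) := by
  rw [← Finset.sum_sub_distrib]
  have := norm_sum_le_of_le (f := fun i => localGrad F X t i - F i x) Finset.univ
    (n := fun _ => L * δ) fun i _ => (hr.lip i _ _).trans (by gcongr; exact hδ i)
  simpa using this

lemma norm_track_le (hw : N.AdmissibleWeights) (hn : 0 < N.n) (hL : 0 ≤ L)
    (hr : IsRun N L γ F x0 X e) (t : ℕ) :
    ‖N.track (localGrad F X + e) t‖ ≤ ‖N.trackErr (localGrad F X + e) t‖ +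
      N.n * ‖e t‖ + N.n * L * ‖N.spread X t‖ + N.n * ‖avgGrad F (N.mid X t)‖ := by
  have h1 : N.track (localGrad F X + e) t = N.trackErr (localGrad F X + e) t +
      act N.pushLim ((localGrad F X + e) t) := by rw [trackErr]; abel
  have h2 : ∑ i, (localGrad F X + e) t i = ∑ i, e t i +
      (∑ i, localGrad F X t i - ∑ i, F i (N.mid X t)) + ∑ i, F i (N.mid X t) := by
    simp only [Pi.add_apply, Finset.sum_add_distrib]
    abel
  have h3 := norm_sum_localGrad_sub_le hL hr t (N.mid X t) (δ := ‖N.spread X t‖)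
    fun i => norm_le_pi_norm (N.spread X t) i
  have h4 := norm_act_pushLim_le hw ((localGrad F X + e) t)
  rw [h2, sum_eq_avgGrad hn] at h4
  have h5 : ‖(N.n : ℝ) • avgGrad F (N.mid X t)‖ = N.n * ‖avgGrad F (N.mid X t)‖ := by
    rw [norm_smul, Real.norm_natCast]
  rw [sum_eq_avgGrad hn] at h3
  have h6 := norm_add₃_le (a := ∑ i, e t i)
    (b := ∑ i, localGrad F X t i - (N.n : ℝ) • avgGrad F (N.mid X t))
    (c := (N.n : ℝ) • avgGrad F (N.mid X t))
  have h7 := norm_sum_le_card_mul (e t)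
  have h8 := norm_add_le (N.trackErr (localGrad F X + e) t)
    (act N.pushLim ((localGrad F X + e) t))
  rw [← h1] at h8
  linarith

/-- How far the noiseless direction is from `n c` times the gradient at the virtual iterate. -/
lemma norm_meanDir_sub_le (hw : N.AdmissibleWeights) (hn : 0 < N.n) (hL : 0 ≤ L) (hγ : 0 ≤ γ)
    (hr : IsRun N L γ F x0 X e) (t : ℕ) :
    ‖N.meanDir (localGrad F X) t - (N.overlap * N.n) • avgGrad F (N.virt γ X e t)‖ ≤
      N.overlap * N.n * L * (‖N.spread X t‖ + γ * ‖N.pending e t‖) +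
        ‖N.trackErr (localGrad F X) t‖ := by
  have h1 : N.meanDir (localGrad F X) t - (N.overlap * N.n) • avgGrad F (N.virt γ X e t) =
      N.overlap • (∑ i, localGrad F X t i - ∑ i, F i (N.virt γ X e t)) +
        comb N.piR (N.trackErr (localGrad F X) t) := by
    rw [trackErr, map_sub, comb_piR_pushLim, meanDir, mul_smul, ← sum_eq_avgGrad hn, smul_sub]
    abel
  have h2 : ∀ i, ‖X t i - N.virt γ X e t‖ ≤ ‖N.spread X t‖ + γ * ‖N.pending e t‖ := fun i => by
    have e1 : X t i - N.virt γ X e t = N.spread X t i - γ • N.pending e t := by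
      simp only [spread, virt, Pi.sub_apply]; abel
    rw [e1]
    refine (norm_sub_le _ _).trans (add_le_add (norm_le_pi_norm _ i) ?_)
    rw [norm_smul, Real.norm_of_nonneg hγ]
  have h3 := norm_sum_localGrad_sub_le hL hr t _ h2
  rw [h1]
  refine (norm_add_le _ _).trans (add_le_add ?_ (norm_comb_piR_le hw _))
  rw [norm_smul, Real.norm_of_nonneg (overlap_nonneg hw)]
  calc _ ≤ N.overlap * _ := mul_le_mul_of_nonneg_left h3 (overlap_nonneg hw)
    _ = _ := by ring

lemma norm_avgGrad_sub_le (hn : 0 < N.n)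
    (hF : ∀ i x y, ‖F i x - F i y‖ ≤ L * ‖x - y‖) (x y : Dec p) :
    ‖avgGrad F x - avgGrad F y‖ ≤ L * ‖x - y‖ := by
  have hn' : (0 : ℝ) < N.n := by exact_mod_cast hn
  rw [avgGrad, avgGrad, ← smul_sub, ← Finset.sum_sub_distrib, norm_smul,
    Real.norm_of_nonneg (by positivity)]
  have := norm_sum_le_of_le (f := fun i => F i x - F i y) Finset.univ
    (n := fun _ => L * ‖x - y‖) fun i _ => hF i _ _
  simp only [Finset.sum_const, Finset.card_univ, Fintype.card_fin, nsmul_eq_mul] at this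
  rw [one_div, inv_mul_le_iff₀ hn']
  exact this

/-! #### Estimates summed over time -/

lemma sum_spread_le (hw : N.AdmissibleWeights) {K : ℝ} (hK : IsGain N.pullDev K)
    (hr : IsRun N L γ F x0 X e) (T : ℕ) :
    ∑ t ∈ Finset.range (T + 1), ‖N.spread X t‖ ^ 2 ≤
      K * (γ ^ 2 * ∑ t ∈ Finset.range T, ‖N.track (localGrad F X + e) t‖ ^ 2) := by
  have h0 : N.spread X 0 = 0 := by
    rw [spread, mid, hr.X_zero, comb_const (piR_spec hw).2.2.1, sub_self]
  have := hK p _ _ (spread_succ hw hr) T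
  rw [h0, norm_zero] at this
  simpa [norm_smul, mul_pow, ← Finset.mul_sum] using this

lemma sum_iterate_step_le (hw : N.AdmissibleWeights) (hγ : 0 ≤ γ) (hr : IsRun N L γ F x0 X e)
    (T : ℕ) : ∑ t ∈ Finset.range T, ‖X (t + 1) - X t‖ ^ 2 ≤
      3 * (2 * ∑ t ∈ Finset.range (T + 1), ‖N.spread X t‖ ^ 2 +
        γ ^ 2 * ∑ t ∈ Finset.range T, ‖N.track (localGrad F X + e) t‖ ^ 2) := by
  have h1 : ∑ t ∈ Finset.range T, ‖X (t + 1) - X t‖ ^ 2 ≤ ∑ t ∈ Finset.range T,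
      3 * (‖N.spread X (t + 1)‖ ^ 2 + ‖N.spread X t‖ ^ 2 +
        γ ^ 2 * ‖N.track (localGrad F X + e) t‖ ^ 2) := by
    refine Finset.sum_le_sum fun t _ => ?_
    rw [← mul_pow]
    exact (pow_le_pow_left₀ (norm_nonneg _) (norm_iterate_step_le hw hγ hr t) 2).trans
      (sq_add_three_le _ _ _)
  rw [← Finset.mul_sum, Finset.sum_add_distrib, Finset.sum_add_distrib, ← Finset.mul_sum] at h1
  have h2 := Finset.sum_range_succ (fun t => ‖N.spread X t‖ ^ 2) T
  have h3 := Finset.sum_range_succ' (fun t => ‖N.spread X t‖ ^ 2) T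
  nlinarith [sq_nonneg ‖N.spread X T‖, sq_nonneg ‖N.spread X 0‖]

lemma sum_localGrad_step_le (hL : 0 ≤ L) (hr : IsRun N L γ F x0 X e) (T : ℕ) :
    ∑ t ∈ Finset.range T, ‖localGrad F X (t + 1) - localGrad F X t‖ ^ 2 ≤
      L ^ 2 * ∑ t ∈ Finset.range T, ‖X (t + 1) - X t‖ ^ 2 := by
  rw [Finset.mul_sum]
  refine Finset.sum_le_sum fun t _ => ?_
  rw [← mul_pow]
  exact pow_le_pow_left₀ (norm_nonneg _) (norm_localGrad_step_le hL hr t) 2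

lemma sum_grad_step_le (hL : 0 ≤ L) (hr : IsRun N L γ F x0 X e) (T : ℕ) :
    ∑ t ∈ Finset.range T, ‖(localGrad F X + e) (t + 1) - (localGrad F X + e) t‖ ^ 2 ≤
      3 * (2 * ∑ t ∈ Finset.range (T + 1), ‖e t‖ ^ 2 +
        L ^ 2 * ∑ t ∈ Finset.range T, ‖X (t + 1) - X t‖ ^ 2) := by
  have h1 : ∑ t ∈ Finset.range T, ‖(localGrad F X + e) (t + 1) - (localGrad F X + e) t‖ ^ 2 ≤
      ∑ t ∈ Finset.range T, 3 * (‖e (t + 1)‖ ^ 2 + ‖e t‖ ^ 2 +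
        ‖localGrad F X (t + 1) - localGrad F X t‖ ^ 2) := by
    refine Finset.sum_le_sum fun t _ => ?_
    refine (pow_le_pow_left₀ (norm_nonneg _) ?_ 2).trans (sq_add_three_le _ _ _)
    have e1 : (localGrad F X + e) (t + 1) - (localGrad F X + e) t =
        e (t + 1) - e t + (localGrad F X (t + 1) - localGrad F X t) := by
      simp only [Pi.add_apply]; abel
    rw [e1]
    exact (norm_add_le _ _).trans (add_le_add_left (norm_sub_le _ _) _)
  rw [← Finset.mul_sum, Finset.sum_add_distrib, Finset.sum_add_distrib] at h1
  have h2 := Finset.sum_range_succ (fun t => ‖e t‖ ^ 2) T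
  have h3 := Finset.sum_range_succ' (fun t => ‖e t‖ ^ 2) T
  have h4 := sum_localGrad_step_le hL hr T
  nlinarith [sq_nonneg ‖e T‖, sq_nonneg ‖e 0‖]

lemma sum_track_le (hw : N.AdmissibleWeights) (hn : 0 < N.n) (hL : 0 ≤ L)
    (hr : IsRun N L γ F x0 X e) (T : ℕ) :
    ∑ t ∈ Finset.range (T + 1), ‖N.track (localGrad F X + e) t‖ ^ 2 ≤
      4 * (∑ t ∈ Finset.range (T + 1), ‖N.trackErr (localGrad F X + e) t‖ ^ 2 +
        N.n ^ 2 * ∑ t ∈ Finset.range (T + 1), ‖e t‖ ^ 2 +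
        N.n ^ 2 * L ^ 2 * ∑ t ∈ Finset.range (T + 1), ‖N.spread X t‖ ^ 2 +
        N.n ^ 2 * ∑ t ∈ Finset.range (T + 1), ‖avgGrad F (N.mid X t)‖ ^ 2) := by
  simp only [Finset.mul_sum, ← Finset.sum_add_distrib]
  refine Finset.sum_le_sum fun t _ => ?_
  simp only [← mul_pow]
  exact (pow_le_pow_left₀ (norm_nonneg _) (norm_track_le hw hn hL hr t) 2).trans
    (sq_add_four_le _ _ _ _)

lemma sum_pending_le (hw : N.AdmissibleWeights) {K : ℝ} (hK0 : 0 ≤ K) (hK : IsGain N.pushDev K)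
    (e : ℕ → Fin N.n → Dec p) (T : ℕ) :
    ∑ t ∈ Finset.range (T + 1), ‖N.pending e t‖ ^ 2 ≤
      2 * (K * ((1 + N.n) ^ 2 * ‖e 0‖ ^ 2 + ∑ t ∈ Finset.range T, ‖e t‖ ^ 2) +
        (T + 1) * ((1 + N.n) ^ 2 * ‖e 0‖ ^ 2)) := by
  have h1 : ∀ t, ‖N.pending e t‖ ^ 2 ≤ 2 * (‖N.lag e t‖ ^ 2 + (1 + N.n) ^ 2 * ‖e 0‖ ^ 2) := by
    intro t
    have h2 : ‖N.pending e t‖ ≤ ‖N.lag e t‖ + (1 + N.n) * ‖e 0‖ :=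
      (norm_comb_piR_le hw _).trans ((norm_add_le _ _).trans
        (add_le_add_right (norm_sub_pushLim_le hw _) _))
    rw [← mul_pow]
    exact (pow_le_pow_left₀ (norm_nonneg _) h2 2).trans add_sq_le
  have h3 := sum_lag_le hw hK0 hK e T
  calc _ ≤ ∑ t ∈ Finset.range (T + 1), 2 * (‖N.lag e t‖ ^ 2 + (1 + N.n) ^ 2 * ‖e 0‖ ^ 2) :=
        Finset.sum_le_sum fun t _ => h1 t
    _ = 2 * (∑ t ∈ Finset.range (T + 1), ‖N.lag e t‖ ^ 2 +
          (T + 1) * ((1 + N.n) ^ 2 * ‖e 0‖ ^ 2)) := by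
        rw [← Finset.mul_sum, Finset.sum_add_distrib]; simp
    _ ≤ _ := by gcongr

end Network

/-! ### The pathwise descent inequality -/

/-- A function with `L`-Lipschitz gradient lies below its quadratic upper model. -/
lemma le_quadratic_of_lipschitz_gradient {p : ℕ} {φ : Dec p → ℝ} {g : Dec p → Dec p} {L : ℝ}
    (hg : ∀ x, HasGradientAt φ (g x) x) (hL : ∀ x y, ‖g x - g y‖ ≤ L * ‖x - y‖) (x v : Dec p) :
    φ (x + v) ≤ φ x + inner ℝ (g x) v + L / 2 * ‖v‖ ^ 2 := by
  let ψ : ℝ → ℝ := fun s => φ (x + s • v) - s * inner ℝ (g x) v - L / 2 * ‖v‖ ^ 2 * s ^ 2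
  have hd : ∀ s, HasDerivAt ψ
      (inner ℝ (g (x + s • v)) v - inner ℝ (g x) v - L / 2 * ‖v‖ ^ 2 * (2 * s)) s := by
    intro s
    have h1 : HasDerivAt (fun s : ℝ => x + s • v) v s := by
      simpa using ((hasDerivAt_id s).smul_const v).const_add x
    have h2 : HasDerivAt (fun s : ℝ => φ (x + s • v)) (inner ℝ (g (x + s • v)) v) s := by
      have := (hg (x + s • v)).hasFDerivAt.comp_hasDerivAt s h1
      exact this.congr_deriv (by simp)
    have h3 : HasDerivAt (fun s : ℝ => s * inner ℝ (g x) v) (inner ℝ (g x) v) s := by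
      simpa using (hasDerivAt_id s).mul_const (inner ℝ (g x) v)
    have h4 : HasDerivAt (fun s : ℝ => L / 2 * ‖v‖ ^ 2 * s ^ 2) (L / 2 * ‖v‖ ^ 2 * (2 * s)) s := by
      simpa using (hasDerivAt_pow 2 s).const_mul (L / 2 * ‖v‖ ^ 2)
    exact (h2.sub h3).sub h4
  have hanti : AntitoneOn ψ (Set.Icc 0 1) := by
    refine antitoneOn_of_deriv_nonpos (convex_Icc 0 1)
      (fun s _ => (hd s).continuousAt.continuousWithinAt)
      (fun s _ => (hd s).differentiableAt.differentiableWithinAt) fun s hs => ?_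
    rw [(hd s).deriv, ← inner_sub_left]
    rw [interior_Icc] at hs
    have h1 := real_inner_le_norm (g (x + s • v) - g x) v
    have h2 := hL (x + s • v) x
    rw [add_sub_cancel_left, norm_smul, Real.norm_of_nonneg hs.1.le] at h2
    nlinarith [norm_nonneg v]
  have := hanti (Set.left_mem_Icc.2 zero_le_one) (Set.right_mem_Icc.2 zero_le_one) zero_le_one
  simp only [ψ, one_smul, zero_smul] at this
  simp at this
  linarith

/-- One step of descent along the direction `D + ζ`, where `D` approximates `a` times the
gradient. -/
lemma descent_step {p : ℕ} {φ : Dec p → ℝ} {g : Dec p → Dec p} {L γ a : ℝ}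
    (hg : ∀ x, HasGradientAt φ (g x) x) (hL : ∀ x y, ‖g x - g y‖ ≤ L * ‖x - y‖)
    (hγ : 0 < γ) (ha : 0 < a) (hs : L * γ * a ≤ 1) (z D ζ : Dec p) :
    γ * a / 2 * ‖g z‖ ^ 2 ≤ φ z - φ (z - γ • (D + ζ)) + γ / (2 * a) * ‖D - a • g z‖ ^ 2 +
      L * γ ^ 2 / 2 * ‖ζ‖ ^ 2 + inner ℝ (-γ • g z + (L * γ ^ 2) • D) ζ := by
  have h1 := le_quadratic_of_lipschitz_gradient hg hL z (-(γ • (D + ζ)))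
  rw [← sub_eq_add_neg, norm_neg, norm_smul, Real.norm_of_nonneg hγ.le, mul_pow,
    norm_add_sq_real, inner_neg_right, inner_smul_right, inner_add_right] at h1
  have h2 : ‖D - a • g z‖ ^ 2 = ‖D‖ ^ 2 - 2 * (a * inner ℝ (g z) D) + a ^ 2 * ‖g z‖ ^ 2 := by
    rw [norm_sub_sq_real, inner_smul_right, norm_smul, mul_pow, Real.norm_of_nonneg ha.le,
      real_inner_comm]
  have h3 : inner ℝ (-γ • g z + (L * γ ^ 2) • D) ζ =
      -γ * inner ℝ (g z) ζ + L * γ ^ 2 * inner ℝ D ζ := by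
    rw [inner_add_left, real_inner_smul_left, real_inner_smul_left]
  have h4 : γ / (2 * a) * ‖D - a • g z‖ ^ 2 =
      γ / (2 * a) * ‖D‖ ^ 2 - γ * inner ℝ (g z) D + γ * a / 2 * ‖g z‖ ^ 2 := by
    rw [h2]; field_simp
  have h5 : L * γ ^ 2 / 2 * ‖D‖ ^ 2 ≤ γ / (2 * a) * ‖D‖ ^ 2 := by
    refine mul_le_mul_of_nonneg_right ?_ (sq_nonneg _)
    rw [div_le_div_iff₀ (by norm_num) (by positivity)]
    nlinarith
  rw [h3, h4]
  nlinarith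

/-- The coupled estimates for the spread `SX`, the tracking variable `SY`, the increments `Sd` of
the iterates, and the tracking errors `SE` (noisy) and `SH` (noiseless), solved for a small
stepsize. All are sums of squares over time, `Se` and `Sg` those of the noise and of the gradients
at the output; `m` is the number of agents and `KR`, `KC` are the gains of the two recursions. -/
lemma solve_coupled (KR KC m L : ℝ) (hKR : 0 ≤ KR) (hKC : 0 ≤ KC) :
    ∃ K γ₀ : ℝ, 0 ≤ K ∧ 0 < γ₀ ∧ ∀ γ SX SY Sd SE SH Se Sg h0 g0 : ℝ, 0 < γ → γ ≤ γ₀ →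
      0 ≤ SY → 0 ≤ Se → 0 ≤ Sg → 0 ≤ h0 → g0 ≤ 2 * (h0 + Se) →
      SX ≤ KR * (γ ^ 2 * SY) → Sd ≤ 3 * (2 * SX + γ ^ 2 * SY) →
      SE ≤ KC * ((1 + m) ^ 2 * g0 + 3 * (2 * Se + L ^ 2 * Sd)) →
      SY ≤ 4 * (SE + m ^ 2 * Se + m ^ 2 * L ^ 2 * SX + m ^ 2 * Sg) →
      SH ≤ KC * ((1 + m) ^ 2 * h0 + L ^ 2 * Sd) →
      SX ≤ K * (γ ^ 2 * (h0 + Se + Sg)) ∧ SH ≤ K * (h0 + γ ^ 2 * (h0 + Se + Sg)) := by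
  set A := 3 * (2 * KR + 1) with hA
  set B := 4 * (KC * (2 * (1 + m) ^ 2 + 6) + m ^ 2) with hB
  set B' := 4 * (KC * (3 * (L ^ 2 * A)) + m ^ 2 * L ^ 2 * KR) with hB'
  have hA0 : 0 ≤ A := by positivity
  have hB0 : 0 ≤ B := by positivity
  have hB0' : 0 ≤ B' := by positivity
  refine ⟨KR * (2 * B) + KC * ((1 + m) ^ 2 + L ^ 2 * (A * (2 * B))), √(1 / (2 * (B' + 1))),
    by positivity, by positivity, ?_⟩
  intro γ SX SY Sd SE SH Se Sg h0 g0 hγ hγ₀ hSY hSe hSg hh0 hg0 hSX hSd hSE hSYle hSH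
  have hγ2 : B' * γ ^ 2 ≤ 1 / 2 := by
    have h1 : γ ^ 2 ≤ 1 / (2 * (B' + 1)) := by
      rw [← Real.sq_sqrt (show 0 ≤ 1 / (2 * (B' + 1)) by positivity)]
      exact pow_le_pow_left₀ hγ.le hγ₀ 2
    rw [le_div_iff₀ (by positivity)] at h1
    nlinarith [sq_nonneg γ]
  have hd : Sd ≤ A * (γ ^ 2 * SY) := by rw [hA]; nlinarith
  have hE : SE ≤ KC * ((1 + m) ^ 2 * (2 * (h0 + Se)) + 3 * (2 * Se + L ^ 2 * (A * (γ ^ 2 * SY)))) :=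
    hSE.trans (by gcongr)
  have hY1 : SY ≤ B * (h0 + Se + Sg) + B' * γ ^ 2 * SY := by
    have h1 : m ^ 2 * L ^ 2 * SX ≤ m ^ 2 * L ^ 2 * (KR * (γ ^ 2 * SY)) := by gcongr
    have h2 : 0 ≤ KC * h0 := by positivity
    have h3 : 0 ≤ KC * Sg := by positivity
    have h4 : 0 ≤ KC * (1 + m) ^ 2 * Sg := by positivity
    have h5 : 0 ≤ m ^ 2 * h0 := by positivity
    rw [hB, hB']
    linarith
  have hY : SY ≤ 2 * B * (h0 + Se + Sg) := by nlinarith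
  have hX : SX ≤ KR * (2 * B) * (γ ^ 2 * (h0 + Se + Sg)) := by
    calc SX ≤ KR * (γ ^ 2 * SY) := hSX
      _ ≤ KR * (γ ^ 2 * (2 * B * (h0 + Se + Sg))) := by gcongr
      _ = _ := by ring
  have hd' : Sd ≤ A * (2 * B) * (γ ^ 2 * (h0 + Se + Sg)) := by
    calc Sd ≤ A * (γ ^ 2 * SY) := hd
      _ ≤ A * (γ ^ 2 * (2 * B * (h0 + Se + Sg))) := by gcongr
      _ = _ := by ring
  have hW : 0 ≤ γ ^ 2 * (h0 + Se + Sg) := by positivity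
  constructor
  · refine hX.trans ?_
    gcongr
    exact le_add_of_nonneg_right (by positivity)
  · calc SH ≤ KC * ((1 + m) ^ 2 * h0 + L ^ 2 * (A * (2 * B) * (γ ^ 2 * (h0 + Se + Sg)))) :=
          hSH.trans (by gcongr)
      _ ≤ KC * ((1 + m) ^ 2 * (h0 + γ ^ 2 * (h0 + Se + Sg)) +
          L ^ 2 * (A * (2 * B)) * (h0 + γ ^ 2 * (h0 + Se + Sg))) := by
          rw [mul_assoc (L ^ 2)]
          gcongr <;> linarith
      _ = KC * ((1 + m) ^ 2 + L ^ 2 * (A * (2 * B))) * (h0 + γ ^ 2 * (h0 + Se + Sg)) := by ring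
      _ ≤ _ := by
          gcongr
          exact le_add_of_nonneg_left (by positivity)

/-- The estimate of the gradients `Sg` at the output, from the descent inequality for the gradients
`Sz` at the virtual iterates and the bounds on the error terms: `Sq` is the pending noise, `Sr` the
error of the noiseless direction, and `a = c n`. -/
lemma solve_descent (K Kq a L : ℝ) (hK : 0 ≤ K) (hKq : 0 ≤ Kq) (ha : 0 < a) :
    ∃ K' γ₀ : ℝ, 0 ≤ K' ∧ 0 < γ₀ ∧ ∀ γ SX SH Sq Sr Sz Sg Se e0 h0 B T : ℝ, 0 < γ → γ ≤ γ₀ →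
      0 ≤ Se → 0 ≤ Sg → 0 ≤ h0 → 0 ≤ e0 → 0 ≤ T →
      SX ≤ K * (γ ^ 2 * (h0 + Se + Sg)) → SH ≤ K * (h0 + γ ^ 2 * (h0 + Se + Sg)) →
      Sq ≤ Kq * (Se + T * e0) → Sr ≤ 3 * ((a * L) ^ 2 * (SX + γ ^ 2 * Sq) + SH) →
      γ * a / 2 * Sz ≤ B + γ / (2 * a) * Sr → Sg ≤ 2 * Sz + 2 * (L ^ 2 * (γ ^ 2 * Sq)) →
      Sg ≤ 8 / (γ * a) * B + K' * (h0 + γ ^ 2 * (Se + T * e0)) := by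
  set A := 6 / a ^ 2 * ((a * L) ^ 2 * (K + Kq) + 2 * K) + 2 * (L ^ 2 * Kq) with hA
  have hA0 : 0 ≤ A := by positivity
  refine ⟨2 * A, min 1 √(1 / (2 * (A + 1))), by positivity, by positivity, ?_⟩
  intro γ SX SH Sq Sr Sz Sg Se e0 h0 B T hγ hγ₀ hSe hSg hh0 he0 hT hSX hSH hSq hSr hSz hSgle
  have hγ1 : γ ^ 2 ≤ 1 := pow_le_one₀ hγ.le (hγ₀.trans (min_le_left _ _))
  have hγ2 : A * γ ^ 2 ≤ 1 / 2 := by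
    have h1 : γ ^ 2 ≤ 1 / (2 * (A + 1)) := by
      rw [← Real.sq_sqrt (show 0 ≤ 1 / (2 * (A + 1)) by positivity)]
      exact pow_le_pow_left₀ hγ.le (hγ₀.trans (min_le_right _ _)) 2
    rw [le_div_iff₀ (by positivity)] at h1
    nlinarith [sq_nonneg γ]
  set W := h0 + γ ^ 2 * (Se + T * e0 + Sg) with hW
  have hTe : 0 ≤ T * e0 := by positivity
  have hg2 : 0 ≤ γ ^ 2 := by positivity
  have hW0 : 0 ≤ W := by positivity
  have b1 : γ ^ 2 * (h0 + Se + Sg) ≤ W := by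
    have := mul_le_of_le_one_left hh0 hγ1
    have := mul_nonneg hg2 hTe
    rw [hW]; linarith
  have b2 : h0 + γ ^ 2 * (h0 + Se + Sg) ≤ 2 * W := by
    have : h0 ≤ W := by rw [hW]; exact le_add_of_nonneg_right (by positivity)
    linarith
  have b3 : γ ^ 2 * (Se + T * e0) ≤ W := by
    have := mul_nonneg hg2 hSg
    rw [hW]; linarith
  have c1 : SX ≤ K * W := hSX.trans (by gcongr)
  have c2 : SH ≤ K * (2 * W) := hSH.trans (by gcongr)
  have c3 : γ ^ 2 * Sq ≤ Kq * W := by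
    calc γ ^ 2 * Sq ≤ γ ^ 2 * (Kq * (Se + T * e0)) := by gcongr
      _ = Kq * (γ ^ 2 * (Se + T * e0)) := by ring
      _ ≤ Kq * W := by gcongr
  have c4 : Sr ≤ 3 * ((a * L) ^ 2 * (K * W + Kq * W) + K * (2 * W)) := hSr.trans (by gcongr)
  have c5 : 2 * Sz ≤ 4 / (γ * a) * B + 2 / a ^ 2 * Sr := by
    have h1 := mul_le_mul_of_nonneg_left hSz (show 0 ≤ 4 / (γ * a) by positivity)
    have e1 : 4 / (γ * a) * (γ * a / 2 * Sz) = 2 * Sz := by field_simp; ring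
    have e2 : 4 / (γ * a) * (B + γ / (2 * a) * Sr) = 4 / (γ * a) * B + 2 / a ^ 2 * Sr := by
      field_simp; ring
    linarith
  have c6 : Sg ≤ 4 / (γ * a) * B + A * W := by
    have h1 : 2 / a ^ 2 * Sr ≤
        2 / a ^ 2 * (3 * ((a * L) ^ 2 * (K * W + Kq * W) + K * (2 * W))) := by
      gcongr
    have h2 : L ^ 2 * (γ ^ 2 * Sq) ≤ L ^ 2 * (Kq * W) := by gcongr
    have h3 : A * W = 2 / a ^ 2 * (3 * ((a * L) ^ 2 * (K * W + Kq * W) + K * (2 * W))) +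
      2 * (L ^ 2 * (Kq * W)) := by rw [hA]; ring
    linarith
  have c7 : A * W ≤ A * (h0 + γ ^ 2 * (Se + T * e0)) + 1 / 2 * Sg := by
    have := mul_le_mul_of_nonneg_right hγ2 hSg
    have e1 : A * W = A * (h0 + γ ^ 2 * (Se + T * e0)) + A * γ ^ 2 * Sg := by rw [hW]; ring
    linarith
  have e1 : 8 / (γ * a) * B = 2 * (4 / (γ * a) * B) := by ring
  linarith

namespace Network

/-- The direction paired with the fresh noise in the descent inequality; it does not depend on the
current samples. -/
def testDir {p : ℕ} (N : Network) (L γ : ℝ) (F : Fin N.n → Dec p → Dec p)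
    (X e : ℕ → Fin N.n → Dec p) (t : ℕ) : Dec p :=
  -γ • avgGrad F (N.virt γ X e t) + (L * γ ^ 2) • N.meanDir (localGrad F X) t

/-- For small stepsizes, every realized run satisfies the rate of centralized gradient descent with
fresh noise of variance `c² n σ²`, up to terms of higher order in the stepsize and up to the
correlation of the noise with the test directions. -/
theorem exists_pathwise_bound {N : Network} (hg : N.CommonRoot) (hw : N.AdmissibleWeights) {L : ℝ}
    (hL : 0 < L) :
    ∃ K γ₀ : ℝ, 0 ≤ K ∧ 0 < γ₀ ∧ ∀ (p : ℕ) (F : Fin N.n → Dec p → Dec p) (x0 : Dec p)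
      (X e : ℕ → Fin N.n → Dec p) (γ : ℝ), 0 < γ → γ ≤ γ₀ → IsRun N L γ F x0 X e →
      ∀ (φ : Dec p → ℝ) (Δ : ℝ), (∀ x, HasGradientAt φ (avgGrad F x) x) →
      (∀ x, φ x0 - φ x ≤ Δ) → ∀ T : ℕ,
      ∑ t ∈ Finset.range (T + 1), ‖avgGrad F (N.mid X t)‖ ^ 2 ≤
        8 / (γ * (N.overlap * N.n)) * (Δ + (L * γ ^ 2 / 2 *
            ∑ t ∈ Finset.range (T + 1), ‖N.freshNoise e t‖ ^ 2 +
            ∑ t ∈ Finset.range (T + 1), inner ℝ (N.testDir L γ F X e t) (N.freshNoise e t))) +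
        K * (‖localGrad F X 0‖ ^ 2 + γ ^ 2 * (∑ t ∈ Finset.range (T + 1), ‖e t‖ ^ 2 +
          ((T : ℝ) + 1) * ‖e 0‖ ^ 2)) := by
  have hn := n_pos hg
  have hn' : (0 : ℝ) < N.n := by exact_mod_cast hn
  have ha : 0 < N.overlap * N.n := mul_pos (overlap_pos hg hw) hn'
  obtain ⟨KR, hKR0, hKR⟩ := exists_isGain_pullDev hw
  obtain ⟨KC, hKC0, hKC⟩ := exists_isGain_pushDev hw
  obtain ⟨K, γ₁, hK, hγ₁, hcoupled⟩ := solve_coupled KR KC N.n L hKR0 hKC0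
  obtain ⟨K', γ₂, hK', hγ₂, hdescent⟩ := solve_descent K (2 * (KC + 1) * (1 + N.n) ^ 2 + 2 * KC)
    (N.overlap * N.n) L hK (by positivity) ha
  refine ⟨K', min (min γ₁ γ₂) (1 / (L * (N.overlap * N.n))), hK', by positivity, ?_⟩
  intro p F x0 X e γ hγ hγle hr φ Δ hφ hΔ T
  have hle₁ : γ ≤ γ₁ := hγle.trans ((min_le_left _ _).trans (min_le_left _ _))
  have hle₂ : γ ≤ γ₂ := hγle.trans ((min_le_left _ _).trans (min_le_right _ _))
  have hle₃ : L * γ * (N.overlap * N.n) ≤ 1 := by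
    have := hγle.trans (min_le_right _ _)
    rw [le_div_iff₀ (by positivity)] at this
    linarith
  have hrange : ∀ u : ℕ → ℝ, (∀ t, 0 ≤ u t) →
      ∑ t ∈ Finset.range T, u t ≤ ∑ t ∈ Finset.range (T + 1), u t := fun u hu => by
    rw [Finset.sum_range_succ]; linarith [hu T]
  have he0 : ‖e 0‖ ^ 2 ≤ ∑ t ∈ Finset.range (T + 1), ‖e t‖ ^ 2 :=
    Finset.single_le_sum (f := fun t => ‖e t‖ ^ 2) (fun t _ => by positivity)
      (Finset.mem_range.2 (Nat.succ_pos T))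
  have hYr := hrange (fun t => ‖N.track (localGrad F X + e) t‖ ^ 2) fun t => by positivity
  have hg0 : ‖(localGrad F X + e) 0‖ ^ 2 ≤
      2 * (‖localGrad F X 0‖ ^ 2 + ∑ t ∈ Finset.range (T + 1), ‖e t‖ ^ 2) := by
    have h1 : ‖(localGrad F X + e) 0‖ ≤ ‖localGrad F X 0‖ + ‖e 0‖ := norm_add_le _ _
    have h2 := (pow_le_pow_left₀ (norm_nonneg _) h1 2).trans add_sq_le
    linarith
  obtain ⟨hSX, hSH⟩ := hcoupled γ (∑ t ∈ Finset.range (T + 1), ‖N.spread X t‖ ^ 2)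
    (∑ t ∈ Finset.range (T + 1), ‖N.track (localGrad F X + e) t‖ ^ 2)
    (∑ t ∈ Finset.range T, ‖X (t + 1) - X t‖ ^ 2)
    (∑ t ∈ Finset.range (T + 1), ‖N.trackErr (localGrad F X + e) t‖ ^ 2)
    (∑ t ∈ Finset.range (T + 1), ‖N.trackErr (localGrad F X) t‖ ^ 2)
    (∑ t ∈ Finset.range (T + 1), ‖e t‖ ^ 2)
    (∑ t ∈ Finset.range (T + 1), ‖avgGrad F (N.mid X t)‖ ^ 2)
    (‖localGrad F X 0‖ ^ 2) (‖(localGrad F X + e) 0‖ ^ 2) hγ hle₁ (by positivity) (by positivity)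
    (by positivity) (by positivity) hg0
    ((sum_spread_le hw hKR hr T).trans (by gcongr))
    ((sum_iterate_step_le hw hγ.le hr T).trans (by gcongr))
    ((sum_trackErr_le hw hKC0 hKC _ T).trans (by gcongr; exact sum_grad_step_le hL.le hr T))
    (sum_track_le hw hn hL.le hr T)
    ((sum_trackErr_le hw hKC0 hKC _ T).trans (by gcongr; exact sum_localGrad_step_le hL.le hr T))
  refine hdescent γ _ _ (∑ t ∈ Finset.range (T + 1), ‖N.pending e t‖ ^ 2)
    (∑ t ∈ Finset.range (T + 1), ‖N.meanDir (localGrad F X) t -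
      (N.overlap * N.n) • avgGrad F (N.virt γ X e t)‖ ^ 2)
    (∑ t ∈ Finset.range (T + 1), ‖avgGrad F (N.virt γ X e t)‖ ^ 2) _ _ _ _ _ _ hγ hle₂
    (by positivity) (by positivity) (by positivity) (by positivity) (by positivity) hSX hSH
    ?_ ?_ ?_ ?_
  · have h1 := sum_pending_le hw hKC0 hKC e T
    have h2 := hrange (fun t => ‖e t‖ ^ 2) fun t => by positivity
    set Se := ∑ t ∈ Finset.range (T + 1), ‖e t‖ ^ 2
    have h3 : KC * ((1 + N.n) ^ 2 * ‖e 0‖ ^ 2 + ∑ t ∈ Finset.range T, ‖e t‖ ^ 2) ≤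
      KC * ((1 + N.n) ^ 2 * Se + Se) := by gcongr
    have h4 : 0 ≤ ((T : ℝ) + 1) * ‖e 0‖ ^ 2 := by positivity
    have h5 : 0 ≤ KC * (1 + (N.n : ℝ)) ^ 2 * (((T : ℝ) + 1) * ‖e 0‖ ^ 2) := by positivity
    have h6 : 0 ≤ KC * (((T : ℝ) + 1) * ‖e 0‖ ^ 2) := by positivity
    have h7 : 0 ≤ (1 + (N.n : ℝ)) ^ 2 * Se := by positivity
    linarith
  · simp only [Finset.mul_sum, ← Finset.sum_add_distrib]
    refine Finset.sum_le_sum fun t _ => ?_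
    have h1 := norm_meanDir_sub_le hw hn hL.le hγ.le hr t
    rw [mul_add] at h1
    have h2 := (pow_le_pow_left₀ (norm_nonneg _) h1 2).trans (sq_add_three_le _ _ _)
    linarith
  · have hstep := fun t => descent_step hφ (norm_avgGrad_sub_le hn hr.lip) hγ ha hle₃
      (N.virt γ X e t) (N.meanDir (localGrad F X) t) (N.freshNoise e t)
    simp only [← virt_succ hw hr] at hstep
    have hsum := Finset.sum_le_sum fun t (_ : t ∈ Finset.range (T + 1)) => hstep t
    simp only [Finset.sum_add_distrib, ← Finset.mul_sum] at hsum
    rw [Finset.sum_range_sub' (fun t => φ (N.virt γ X e t)), virt_zero hw hr] at hsum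
    have := hΔ (N.virt γ X e (T + 1))
    simp only [testDir]
    linarith
  · simp only [Finset.mul_sum, ← Finset.sum_add_distrib]
    refine Finset.sum_le_sum fun t _ => ?_
    have h1 := norm_avgGrad_sub_le hn hr.lip (N.mid X t) (N.virt γ X e t)
    have e1 : N.mid X t - N.virt γ X e t = -(γ • N.pending e t) := by rw [virt]; abel
    rw [e1, norm_neg, norm_smul, Real.norm_of_nonneg hγ.le] at h1
    have h2 : ‖avgGrad F (N.mid X t)‖ ≤
        ‖avgGrad F (N.virt γ X e t)‖ + L * (γ * ‖N.pending e t‖) := by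
      have := norm_le_norm_add_norm_sub' (avgGrad F (N.mid X t)) (avgGrad F (N.virt γ X e t))
      linarith
    have h3 := (pow_le_pow_left₀ (norm_nonneg _) h2 2).trans add_sq_le
    rw [mul_pow, mul_pow] at h3
    linarith

end Network

/-! ### Moments of the gradient noise -/

section Moments

variable {Ω : Type v} [MeasurableSpace Ω] {μ : Measure Ω} [IsProbabilityMeasure μ]
  {S : Type u} [MeasurableSpace S] {D : Measure S} [IsProbabilityMeasure D] {p : ℕ}
  {G : Dec p → S → Dec p} {m : Dec p → Dec p} {x : Ω → Dec p} {ζ : Ω → S}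

/-- Evaluated at an independent random point, the stochastic gradient keeps its variance bound. -/
lemma integrable_sq_noise {σ : ℝ}
    (hG : Measurable fun q : Dec p × S => G q.1 q.2) (hm : Measurable m)
    (hi : ∀ x, Integrable (fun s => ‖G x s - m x‖ ^ 2) D)
    (hσ : ∀ x, ∫ s, ‖G x s - m x‖ ^ 2 ∂D ≤ σ ^ 2)
    (hx : Measurable x) (hζ : Measurable ζ) (hD : μ.map ζ = D) (hxζ : IndepFun x ζ μ) :
    Integrable (fun ω => ‖G (x ω) (ζ ω) - m (x ω)‖ ^ 2) μ ∧
      ∫ ω, ‖G (x ω) (ζ ω) - m (x ω)‖ ^ 2 ∂μ ≤ σ ^ 2 := by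
  have hlaw : μ.map (fun ω => (x ω, ζ ω)) = (μ.map x).prod D := by
    rw [(indepFun_iff_map_prod_eq_prod_map_map hx.aemeasurable hζ.aemeasurable).1 hxζ, hD]
  have : IsProbabilityMeasure (μ.map x) := Measure.isProbabilityMeasure_map hx.aemeasurable
  have hk : Measurable fun q : Dec p × S => ‖G q.1 q.2 - m q.1‖ ^ 2 := by fun_prop
  have hint : Integrable (fun q : Dec p × S => ‖G q.1 q.2 - m q.1‖ ^ 2) ((μ.map x).prod D) := by
    rw [integrable_prod_iff hk.aestronglyMeasurable]
    refine ⟨Filter.Eventually.of_forall hi, ?_⟩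
    refine Integrable.of_bound (C := σ ^ 2) ?_ (Filter.Eventually.of_forall fun y => ?_)
    · exact hk.stronglyMeasurable.norm.integral_prod_right'.aestronglyMeasurable
    · rw [Real.norm_of_nonneg (integral_nonneg fun _ => norm_nonneg _)]
      simpa using hσ y
  have hpair : Measurable fun ω => (x ω, ζ ω) := hx.prodMk hζ
  rw [← hlaw] at hint
  refine ⟨(integrable_map_measure hk.aestronglyMeasurable hpair.aemeasurable).1 hint, ?_⟩
  have h1 := integral_map hpair.aemeasurable hk.aestronglyMeasurable (μ := μ)
  simp only at h1
  rw [← h1, hlaw, integral_prod _ (hlaw ▸ hint)]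
  refine (integral_mono (hlaw ▸ hint).integral_prod_left (integrable_const _) hσ).trans ?_
  simp

/-- The noise is orthogonal to every `φ` that is, jointly with the query point, independent of the
sample. -/
lemma integral_inner_noise_eq_zero {φ : Ω → Dec p}
    (hG : Measurable fun q : Dec p × S => G q.1 q.2) (hm : Measurable m)
    (hi : ∀ x, Integrable (G x) D) (hmean : ∀ x, ∫ s, G x s ∂D = m x)
    (hx : Measurable x) (hφ : Measurable φ) (hζ : Measurable ζ) (hD : μ.map ζ = D)
    (hxζ : IndepFun (fun ω => (x ω, φ ω)) ζ μ)
    (hφe : Integrable (fun ω => inner ℝ (φ ω) (G (x ω) (ζ ω) - m (x ω))) μ) :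
    ∫ ω, inner ℝ (φ ω) (G (x ω) (ζ ω) - m (x ω)) ∂μ = 0 := by
  have hxφ : Measurable fun ω => (x ω, φ ω) := hx.prodMk hφ
  have hlaw : μ.map (fun ω => ((x ω, φ ω), ζ ω)) = (μ.map fun ω => (x ω, φ ω)).prod D := by
    rw [(indepFun_iff_map_prod_eq_prod_map_map hxφ.aemeasurable hζ.aemeasurable).1 hxζ, hD]
  have : IsProbabilityMeasure (μ.map fun ω => (x ω, φ ω)) :=
    Measure.isProbabilityMeasure_map hxφ.aemeasurable
  have hG' : Measurable fun q : (Dec p × Dec p) × S => G q.1.1 q.2 :=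
    hG.comp ((measurable_fst.comp measurable_fst).prodMk measurable_snd)
  have hk : Measurable fun q : (Dec p × Dec p) × S => inner ℝ q.1.2 (G q.1.1 q.2 - m q.1.1) := by
    fun_prop
  have hpair : Measurable fun ω => ((x ω, φ ω), ζ ω) := hxφ.prodMk hζ
  have hint := (integrable_map_measure hk.aestronglyMeasurable hpair.aemeasurable).2 hφe
  have h1 := integral_map hpair.aemeasurable hk.aestronglyMeasurable (μ := μ)
  simp only at h1
  rw [hlaw] at hint
  rw [← h1, hlaw, integral_prod _ hint]
  refine integral_eq_zero_of_ae (Filter.Eventually.of_forall fun y => ?_)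
  have h2 : Integrable (fun s => G y.1 s - m y.1) D := (hi _).sub (integrable_const _)
  simp only [Pi.zero_apply]
  rw [integral_inner h2, integral_sub (hi _) (integrable_const _), hmean]
  simp

end Moments

/-! ### Linear closure of the iterates -/

section Closure

variable {Ω : Type v} {p : ℕ} {N : Network}

/-- The measurable functions with values in the decision space. -/
def measurableFunctions (Ω : Type v) [MeasurableSpace Ω] (p : ℕ) : Submodule ℝ (Ω → Dec p) where
  carrier := {f | Measurable f}
  add_mem' hf hg := Measurable.add hf hg
  zero_mem' := measurable_const
  smul_mem' c _ hf := Measurable.const_smul hf c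

/-- The square-integrable functions with values in the decision space. -/
def squareIntegrable {Ω : Type v} [MeasurableSpace Ω] (μ : Measure Ω) (p : ℕ) :
    Submodule ℝ (Ω → Dec p) where
  carrier := {f | MemLp f 2 μ}
  add_mem' hf hg := MemLp.add hf hg
  zero_mem' := MemLp.zero'
  smul_mem' c _ hf := MemLp.const_smul hf c

variable (V : Submodule ℝ (Ω → Dec p))

lemma comb_mem {n : ℕ} {Z : Ω → Fin n → Dec p} (hZ : ∀ i, (fun ω => Z ω i) ∈ V)
    (w : Fin n → ℝ) : (fun ω => comb w (Z ω)) ∈ V := by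
  have : (fun ω => comb w (Z ω)) = ∑ j, w j • fun ω => Z ω j := by
    ext1 ω; simp [comb_apply]
  rw [this]
  exact V.sum_mem fun j _ => V.smul_mem _ (hZ j)

lemma act_mem {n : ℕ} {Z : Ω → Fin n → Dec p} (hZ : ∀ i, (fun ω => Z ω i) ∈ V)
    (A : Matrix (Fin n) (Fin n) ℝ) (i : Fin n) : (fun ω => act A (Z ω) i) ∈ V :=
  comb_mem V hZ (A i)

lemma track_mem {g : Ω → ℕ → Fin N.n → Dec p} {t : ℕ}
    (hg : ∀ k ≤ t, ∀ i, (fun ω => g ω k i) ∈ V) (i : Fin N.n) :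
    (fun ω => N.track (g ω) t i) ∈ V := by
  induction t generalizing i with
  | zero => exact hg 0 le_rfl i
  | succ t ih =>
    refine act_mem V (Z := fun ω => N.track (g ω) t + (g ω (t + 1) - g ω t)) (fun j => ?_) N.C i
    exact V.add_mem (ih (fun k hk => hg k (hk.trans t.le_succ)) j)
      (V.sub_mem (hg (t + 1) le_rfl j) (hg t t.le_succ j))

lemma initial_mem {g : Ω → ℕ → Fin N.n → Dec p} (h0 : ∀ i, (fun ω => g ω 0 i) ∈ V)
    (i : Fin N.n) : (fun ω => (g ω 0 - act N.pushLim (g ω 0)) i) ∈ V :=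
  V.sub_mem (h0 i) (act_mem V (Z := fun ω => g ω 0) h0 N.pushLim i)

lemma lag_mem {g : Ω → ℕ → Fin N.n → Dec p} {t : ℕ} (h0 : ∀ i, (fun ω => g ω 0 i) ∈ V)
    (hg : ∀ k < t, ∀ i, (fun ω => g ω k i) ∈ V) (i : Fin N.n) :
    (fun ω => N.lag (g ω) t i) ∈ V := by
  induction t generalizing i with
  | zero => exact V.neg_mem (initial_mem V h0 i)
  | succ t ih =>
    refine act_mem V (Z := fun ω => N.lag (g ω) t + g ω t) (fun j => ?_) N.pushDev i
    exact V.add_mem (ih (fun k hk => hg k (hk.trans t.lt_succ_self)) j) (hg t t.lt_succ_self j)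

lemma pending_mem {g : Ω → ℕ → Fin N.n → Dec p} {t : ℕ}
    (hg : ∀ k < t, ∀ i, (fun ω => g ω k i) ∈ V) : (fun ω => N.pending (g ω) t) ∈ V := by
  cases t with
  | zero =>
    have h0 : (fun ω => N.pending (g ω) 0) = 0 := by
      ext1 ω
      have h0 : N.lag (g ω) 0 = -(g ω 0 - act N.pushLim (g ω 0)) := rfl
      rw [Network.pending, h0, neg_add_cancel, map_zero, Pi.zero_apply]
    rw [h0]
    exact V.zero_mem
  | succ t =>
    have h0 := hg 0 t.succ_pos
    exact comb_mem V (Z := fun ω => N.lag (g ω) (t + 1) + (g ω 0 - act N.pushLim (g ω 0)))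
      (fun i => V.add_mem (lag_mem V h0 hg i) (initial_mem V h0 i)) N.piR

end Closure

/-! ### The random run -/

namespace Problem

variable {N : Network} {p : ℕ}

/-- The iterates `X t` of the agents. -/
def path (P : Problem.{u} N.n p) (γ : ℝ) (x0 : Dec p) (s : ℕ → ∀ i, P.S i) (t : ℕ) :
    Fin N.n → Dec p := (P.iterate N.R N.C γ x0 s t).1

/-- The gradient noise along the iterates. -/
def noise (P : Problem.{u} N.n p) (γ : ℝ) (x0 : Dec p) (s : ℕ → ∀ i, P.S i) (t : ℕ) :
    Fin N.n → Dec p := fun i =>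
  P.g i (P.path γ x0 s t i) (s t i) - gradient (P.f i) (P.path γ x0 s t i)

/-- The local gradients. -/
abbrev grad (P : Problem.{u} N.n p) (i : Fin N.n) : Dec p → Dec p := gradient (P.f i)

variable {P : Problem.{u} N.n p} {L σ γ : ℝ} {x0 : Dec p}

lemma localGrad_add_noise (s : ℕ → ∀ i, P.S i) (t : ℕ) :
    (localGrad P.grad (P.path γ x0 s) + P.noise γ x0 s) t =
      fun i => P.g i (P.path γ x0 s t i) (s t i) := by
  ext1 i
  simp [localGrad, noise]

/-- The second component of the iterates is the push recursion driven by the stochastic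
gradients. -/
lemma iterate_snd (s : ℕ → ∀ i, P.S i) (t : ℕ) :
    (P.iterate N.R N.C γ x0 s t).2 =
      N.track (localGrad P.grad (P.path γ x0 s) + P.noise γ x0 s) t := by
  induction t with
  | zero => rw [Network.track, localGrad_add_noise]; rfl
  | succ t ih =>
    rw [Network.track, ← ih, localGrad_add_noise, localGrad_add_noise]
    ext1 i
    simp only [iterate, act_apply, path, Pi.add_apply, Pi.sub_apply, add_sub_assoc]

lemma Smooth.isRun (hP : P.Smooth L) (γ : ℝ) (x0 : Dec p) (s : ℕ → ∀ i, P.S i) :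
    IsRun N L γ P.grad x0 (P.path γ x0 s) (P.noise γ x0 s) where
  lip := hP.lipschitz
  X_zero := rfl
  X_succ t := by
    rw [← iterate_snd]
    rfl

lemma Smooth.measurable_grad (hP : P.Smooth L) (i : Fin N.n) : Measurable (P.grad i) := by
  have h : LipschitzWith L.toNNReal (P.grad i) := LipschitzWith.of_dist_le_mul fun x y => by
    rw [dist_eq_norm, dist_eq_norm]
    refine (hP.lipschitz i x y).trans ?_
    gcongr
    exact Real.le_coe_toNNReal L
  exact h.continuous.measurable

lemma Smooth.hasGradientAt_obj (hP : P.Smooth L) (x : Dec p) :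
    HasGradientAt P.obj (avgGrad P.grad x) x := by
  have h1 : ∀ i, HasFDerivAt (P.f i) (InnerProductSpace.toDual ℝ (Dec p) (P.grad i x)) x :=
    fun i => ((hP.differentiable i) x).hasGradientAt.hasFDerivAt
  have h2 : HasFDerivAt (fun y => ∑ i, P.f i y)
      (∑ i, InnerProductSpace.toDual ℝ (Dec p) (P.grad i x)) x :=
    HasFDerivAt.fun_sum fun i _ => h1 i
  rw [hasGradientAt_iff_hasFDerivAt, avgGrad]
  have h3 := h2.const_mul (1 / (N.n : ℝ))
  refine h3.congr_fderiv ?_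
  rw [map_smulₛₗ, map_sum]
  rfl

lemma Smooth.obj_sub_le (hP : P.Smooth L) {Δ : ℝ} (hΔ : P.obj x0 - (⨅ x, P.obj x) ≤ Δ)
    (x : Dec p) : P.obj x0 - P.obj x ≤ Δ := by
  have hb : BddBelow (Set.range P.obj) := by
    choose b hb using hP.bddBelow
    refine ⟨1 / (N.n : ℝ) * ∑ i, b i, ?_⟩
    rintro _ ⟨y, rfl⟩
    unfold obj
    gcongr with i
    exact hb i ⟨y, rfl⟩
  linarith [ciInf_le hb x]

/-! #### Measurability -/

section Measurability

variable {Ω : Type v} [MeasurableSpace Ω] {ξ : ℕ → ∀ i, Ω → P.S i}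

/-- The iterates at time `t` are measurable with respect to the samples drawn before `t`. -/
lemma measurable_path (hN : P.NoisyGradients σ) {t : ℕ} (hξ : ∀ k < t, ∀ i, Measurable (ξ k i))
    (i : Fin N.n) : Measurable fun ω => P.path γ x0 (fun k i => ξ k i ω) t i := by
  have key : ∀ t, (∀ k < t, ∀ i, Measurable (ξ k i)) → ∀ k ≤ t, ∀ i,
      Measurable fun ω => P.path γ x0 (fun k i => ξ k i ω) k i := by
    intro t
    induction t with
    | zero =>
      intro _ k hk i
      obtain rfl : k = 0 := by omega
      exact measurable_const
    | succ t ih =>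
      intro hξ k hk i
      have ih' := ih fun k hk => hξ k (hk.trans t.lt_succ_self)
      rcases Nat.le_succ_iff.1 hk with hk | rfl
      · exact ih' k hk i
      · have hY : ∀ j, Measurable fun ω => (P.iterate N.R N.C γ x0 (fun k i => ξ k i ω) t).2 j := by
          intro j
          simp only [iterate_snd]
          refine track_mem (measurableFunctions Ω p) (g := fun ω =>
            localGrad P.grad (P.path γ x0 fun k i => ξ k i ω) +
              P.noise γ x0 fun k i => ξ k i ω) (fun k hk l => ?_) j
          simp only [localGrad_add_noise]
          exact (hN.meas l).comp ((ih' k hk l).prodMk (hξ k (by omega) l))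
        refine act_mem (measurableFunctions Ω p) (Z := fun ω =>
          (P.iterate N.R N.C γ x0 (fun k i => ξ k i ω) t).1 -
            γ • (P.iterate N.R N.C γ x0 (fun k i => ξ k i ω) t).2) (fun j => ?_) N.R i
        exact (measurableFunctions Ω p).sub_mem (ih' t le_rfl j)
          ((measurableFunctions Ω p).smul_mem γ (hY j))
  exact key t hξ t le_rfl i

lemma measurable_noise (hN : P.NoisyGradients σ) (hP : P.Smooth L) {t : ℕ}
    (hξ : ∀ k < t, ∀ i, Measurable (ξ k i)) {i : Fin N.n} (hi : Measurable (ξ t i)) :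
    Measurable fun ω => P.noise γ x0 (fun k i => ξ k i ω) t i := by
  have hX := measurable_path (γ := γ) (x0 := x0) hN hξ i
  exact ((hN.meas i).comp (hX.prodMk hi)).sub ((hP.measurable_grad i).comp hX)

/-- The test direction at time `t` is measurable with respect to the samples drawn before `t`. -/
lemma measurable_testDir (hN : P.NoisyGradients σ) (hP : P.Smooth L) {t : ℕ}
    (hξ : ∀ k < t, ∀ i, Measurable (ξ k i)) :
    Measurable fun ω => N.testDir L γ P.grad (P.path γ x0 fun k i => ξ k i ω)
      (P.noise γ x0 fun k i => ξ k i ω) t := by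
  have hX : ∀ k ≤ t, ∀ i, Measurable fun ω => P.path γ x0 (fun k i => ξ k i ω) k i :=
    fun k hk i => measurable_path hN (fun l hl => hξ l (hl.trans_le hk)) i
  have he : ∀ k < t, ∀ i, Measurable fun ω => P.noise γ x0 (fun k i => ξ k i ω) k i :=
    fun k hk i => measurable_noise hN hP (fun l hl => hξ l (hl.trans hk)) (hξ k hk i)
  have hmid : Measurable fun ω => N.mid (P.path γ x0 fun k i => ξ k i ω) t :=
    comb_mem (measurableFunctions Ω p) (hX t le_rfl) N.piR
  have hpend : Measurable fun ω => N.pending (P.noise γ x0 fun k i => ξ k i ω) t :=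
    pending_mem (measurableFunctions Ω p) he
  have hmean : Measurable fun ω =>
      N.meanDir (localGrad P.grad (P.path γ x0 fun k i => ξ k i ω)) t :=
    comb_mem (measurableFunctions Ω p) (track_mem (measurableFunctions Ω p) fun k hk i =>
      (hP.measurable_grad i).comp (hX k hk i)) N.piR
  have havg : Measurable (avgGrad P.grad) := by
    have h1 : Measurable fun x => ∑ i, P.grad i x :=
      Finset.measurable_fun_sum _ fun i _ => hP.measurable_grad i
    exact h1.const_smul (1 / (N.n : ℝ))
  exact ((havg.comp (hmid.add (hpend.const_smul γ))).const_smul (-γ)).add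
    (hmean.const_smul (L * γ ^ 2))

end Measurability

/-! #### Independence and square integrability -/

section Integrability

variable {Ω : Type v} {ξ : ℕ → ∀ i, Ω → P.S i}

/-- The σ-algebra of all samples but the one of agent `i` at time `t`. -/
abbrev others (ξ : ℕ → ∀ i, Ω → P.S i) (t : ℕ) (i : Fin N.n) : MeasurableSpace Ω :=
  ⨆ q ∈ {q : ℕ × Fin N.n | q ≠ (t, i)}, (P.mS q.2).comap (ξ q.1 q.2)

lemma measurable_others {t k : ℕ} {i j : Fin N.n} (h : (k, j) ≠ (t, i)) :
    Measurable[others ξ t i] (ξ k j) := by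
  rw [measurable_iff_comap_le]
  exact le_iSup₂_of_le (f := fun (q : ℕ × Fin N.n) (_ : q ∈ {q : ℕ × Fin N.n | q ≠ (t, i)}) =>
    (P.mS q.2).comap (ξ q.1 q.2)) (k, j) h le_rfl

lemma measurable_others_of_lt {t : ℕ} {i : Fin N.n} :
    ∀ k < t, ∀ j, Measurable[others ξ t i] (ξ k j) := fun _ hk _ =>
  measurable_others fun h => hk.ne (congrArg Prod.fst h)

lemma measurable_path_others (hN : P.NoisyGradients σ) (t : ℕ) (i j : Fin N.n) :
    Measurable[others ξ t i] fun ω => P.path γ x0 (fun k i => ξ k i ω) t j :=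
  @measurable_path _ _ P σ γ x0 Ω (others ξ t i) ξ hN t measurable_others_of_lt j

variable [mΩ : MeasurableSpace Ω] {μ : Measure Ω}

lemma IsSampling.others_le (hS : P.IsSampling μ ξ) (t : ℕ) (i : Fin N.n) : others ξ t i ≤ mΩ :=
  iSup₂_le fun q _ => (hS.meas q.1 q.2).comap_le

lemma IsSampling.indepFun_of_measurable_others (hS : P.IsSampling μ ξ) {β : Type*}
    [MeasurableSpace β] {ψ : Ω → β} {t : ℕ} {i : Fin N.n} (hψ : Measurable[others ξ t i] ψ) :
    IndepFun ψ (ξ t i) μ := by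
  have h1 := indep_iSup_of_disjoint (fun q : ℕ × Fin N.n => (hS.meas q.1 q.2).comap_le) hS.indep
    (S := {q | q ≠ (t, i)}) (T := {(t, i)}) (by simp)
  rw [IndepFun_iff_Indep]
  refine indep_of_indep_of_le_left (indep_of_indep_of_le_right h1 ?_) hψ.comap_le
  exact le_iSup₂_of_le (f := fun (q : ℕ × Fin N.n) (_ : q ∈ ({(t, i)} : Set (ℕ × Fin N.n))) =>
    (P.mS q.2).comap (ξ q.1 q.2)) (t, i) rfl le_rfl

lemma integrable_inner_of_memLp {f g : Ω → Dec p} (hf : MemLp f 2 μ) (hg : MemLp g 2 μ) :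
    Integrable (fun ω => inner ℝ (f ω) (g ω)) μ := by
  refine (MemLp.integrable_mul hf.norm hg.norm).mono (hf.1.inner hg.1)
    (Filter.Eventually.of_forall fun ω => ?_)
  simpa using abs_real_inner_le_norm (f ω) (g ω)

variable [IsProbabilityMeasure μ]

lemma memLp_noise (hN : P.NoisyGradients σ) (hP : P.Smooth L) (hS : P.IsSampling μ ξ) (t : ℕ)
    (i : Fin N.n) : MemLp (fun ω => P.noise γ x0 (fun k i => ξ k i ω) t i) 2 μ ∧
      ∫ ω, ‖P.noise γ x0 (fun k i => ξ k i ω) t i‖ ^ 2 ∂μ ≤ σ ^ 2 := by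
  have := hN.prob i
  have hind := hS.indepFun_of_measurable_others
    (measurable_path_others (ξ := ξ) (γ := γ) (x0 := x0) hN t i i)
  have h := integrable_sq_noise (hN.meas i) (hP.measurable_grad i) (hN.integrable_sq i)
    (hN.variance_le i) (measurable_path hN (fun k _ => hS.meas k) i) (hS.meas t i) (hS.law t i) hind
  refine ⟨?_, h.2⟩
  exact (memLp_two_iff_integrable_sq_norm
    (measurable_noise hN hP (fun k _ => hS.meas k) (hS.meas t i)).aestronglyMeasurable).2 h.1

lemma memLp_grad_comp (hP : P.Smooth L) {x : Ω → Dec p} (hx : MemLp x 2 μ) (i : Fin N.n) :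
    MemLp (fun ω => P.grad i (x ω)) 2 μ := by
  have h1 : MemLp (fun ω => P.grad i (x ω) - P.grad i 0) 2 μ := by
    refine hx.of_le_mul (c := L) ?_ (Filter.Eventually.of_forall fun ω => ?_)
    · exact (((hP.measurable_grad i).comp_aemeasurable hx.1.aemeasurable).sub_const
        _).aestronglyMeasurable
    · simpa using hP.lipschitz i (x ω) 0
  refine (h1.add (memLp_const (P.grad i 0))).ae_eq (Filter.Eventually.of_forall fun ω => ?_)
  simp

lemma memLp_path (hN : P.NoisyGradients σ) (hP : P.Smooth L) (hS : P.IsSampling μ ξ) (t : ℕ)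
    (i : Fin N.n) : MemLp (fun ω => P.path γ x0 (fun k i => ξ k i ω) t i) 2 μ := by
  induction t using Nat.strong_induction_on generalizing i with
  | _ t ih =>
    cases t with
    | zero => exact memLp_const x0
    | succ t =>
      refine act_mem (squareIntegrable μ p) (Z := fun ω =>
        (P.iterate N.R N.C γ x0 (fun k i => ξ k i ω) t).1 -
          γ • (P.iterate N.R N.C γ x0 (fun k i => ξ k i ω) t).2) (fun j => ?_) N.R i
      refine (squareIntegrable μ p).sub_mem (ih t t.lt_succ_self j)
        ((squareIntegrable μ p).smul_mem γ ?_)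
      simp only [iterate_snd]
      refine track_mem (squareIntegrable μ p) (g := fun ω =>
        localGrad P.grad (P.path γ x0 fun k i => ξ k i ω) +
          P.noise γ x0 fun k i => ξ k i ω) (fun k hk l => ?_) j
      exact (memLp_grad_comp hP (ih k (Nat.lt_succ_of_le hk) l) l).add (memLp_noise hN hP hS k l).1

lemma memLp_avgGrad_comp (hP : P.Smooth L) {x : Ω → Dec p} (hx : MemLp x 2 μ) :
    MemLp (fun ω => avgGrad P.grad (x ω)) 2 μ := by
  have h1 : MemLp (fun ω => ∑ i, P.grad i (x ω)) 2 μ :=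
    memLp_finsetSum _ fun i _ => memLp_grad_comp hP hx i
  exact h1.const_smul (1 / (N.n : ℝ))

lemma memLp_mid (hN : P.NoisyGradients σ) (hP : P.Smooth L) (hS : P.IsSampling μ ξ) (t : ℕ) :
    MemLp (fun ω => N.mid (P.path γ x0 fun k i => ξ k i ω) t) 2 μ :=
  comb_mem (squareIntegrable μ p) (memLp_path hN hP hS t) N.piR

lemma memLp_testDir (hN : P.NoisyGradients σ) (hP : P.Smooth L) (hS : P.IsSampling μ ξ) (t : ℕ) :
    MemLp (fun ω => N.testDir L γ P.grad (P.path γ x0 fun k i => ξ k i ω)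
      (P.noise γ x0 fun k i => ξ k i ω) t) 2 μ := by
  have hpend : MemLp (fun ω => N.pending (P.noise γ x0 fun k i => ξ k i ω) t) 2 μ :=
    pending_mem (squareIntegrable μ p) fun k _ i => (memLp_noise hN hP hS k i).1
  have hmean : MemLp (fun ω =>
      N.meanDir (localGrad P.grad (P.path γ x0 fun k i => ξ k i ω)) t) 2 μ :=
    comb_mem (squareIntegrable μ p) (track_mem (squareIntegrable μ p) fun k _ i =>
      memLp_grad_comp hP (memLp_path hN hP hS k i) i) N.piR
  exact ((memLp_avgGrad_comp hP ((memLp_mid hN hP hS t).add (hpend.const_smul γ))).const_smul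
    (-γ)).add (hmean.const_smul (L * γ ^ 2))

/-- The noise of agent `i` at time `t` is orthogonal to everything that is determined by the other
samples. -/
lemma integral_inner_noise (hN : P.NoisyGradients σ) (hP : P.Smooth L) (hS : P.IsSampling μ ξ)
    {t : ℕ} {i : Fin N.n} {φ : Ω → Dec p} (hφ : Measurable[others ξ t i] φ) (hφ2 : MemLp φ 2 μ) :
    ∫ ω, inner ℝ (φ ω) (P.noise γ x0 (fun k i => ξ k i ω) t i) ∂μ = 0 := by
  have := hN.prob i
  have hX := measurable_path_others (ξ := ξ) (γ := γ) (x0 := x0) hN t i i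
  have hind := hS.indepFun_of_measurable_others (hX.prodMk hφ)
  exact integral_inner_noise_eq_zero (hN.meas i) (hP.measurable_grad i) (hN.integrable i)
    (hN.unbiased i) (hX.mono (hS.others_le t i) le_rfl) (hφ.mono (hS.others_le t i) le_rfl)
    (hS.meas t i) (hS.law t i) hind
    (integrable_inner_of_memLp hφ2 (memLp_noise hN hP hS t i).1)

lemma integral_testDir_freshNoise (hN : P.NoisyGradients σ) (hP : P.Smooth L)
    (hS : P.IsSampling μ ξ) (t : ℕ) :
    Integrable (fun ω => inner ℝ (N.testDir L γ P.grad (P.path γ x0 fun k i => ξ k i ω)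
        (P.noise γ x0 fun k i => ξ k i ω) t)
      (N.freshNoise (P.noise γ x0 fun k i => ξ k i ω) t)) μ ∧
    ∫ ω, inner ℝ (N.testDir L γ P.grad (P.path γ x0 fun k i => ξ k i ω)
        (P.noise γ x0 fun k i => ξ k i ω) t)
      (N.freshNoise (P.noise γ x0 fun k i => ξ k i ω) t) ∂μ = 0 := by
  simp only [Network.freshNoise, inner_smul_right, inner_sum]
  have hi := fun i => integrable_inner_of_memLp (memLp_testDir (γ := γ) (x0 := x0) hN hP hS t)
    (memLp_noise (γ := γ) (x0 := x0) hN hP hS t i).1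
  refine ⟨(integrable_finsetSum _ fun i _ => hi i).const_mul _, ?_⟩
  rw [integral_const_mul, integral_finsetSum _ fun i _ => hi i, Finset.sum_eq_zero, mul_zero]
  intro i _
  exact integral_inner_noise hN hP hS
    (@measurable_testDir _ _ P L σ γ x0 Ω (others ξ t i) ξ hN hP t measurable_others_of_lt)
    (memLp_testDir hN hP hS t)

/-- The noise of different agents is uncorrelated, so its variances add up. -/
lemma integral_freshNoise_sq_le (hN : P.NoisyGradients σ) (hP : P.Smooth L)
    (hS : P.IsSampling μ ξ) (t : ℕ) :
    Integrable (fun ω => ‖N.freshNoise (P.noise γ x0 fun k i => ξ k i ω) t‖ ^ 2) μ ∧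
    ∫ ω, ‖N.freshNoise (P.noise γ x0 fun k i => ξ k i ω) t‖ ^ 2 ∂μ ≤
      N.overlap ^ 2 * (N.n * σ ^ 2) := by
  have hexp : ∀ ω, ‖N.freshNoise (P.noise γ x0 fun k i => ξ k i ω) t‖ ^ 2 = N.overlap ^ 2 *
      ∑ i, ∑ j, inner ℝ (P.noise γ x0 (fun k i => ξ k i ω) t i)
        (P.noise γ x0 (fun k i => ξ k i ω) t j) := fun ω => by
    rw [Network.freshNoise, norm_smul, mul_pow, Real.norm_eq_abs, sq_abs,
      ← real_inner_self_eq_norm_sq, sum_inner]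
    simp only [inner_sum]
  have hi := fun i j => integrable_inner_of_memLp (memLp_noise (γ := γ) (x0 := x0) hN hP hS t i).1
    (memLp_noise (γ := γ) (x0 := x0) hN hP hS t j).1
  simp only [hexp]
  have hi2 := fun i => integrable_finsetSum Finset.univ fun j (_ : j ∈ Finset.univ) => hi i j
  refine ⟨(integrable_finsetSum _ fun i _ => hi2 i).const_mul _, ?_⟩
  rw [integral_const_mul, integral_finsetSum _ fun i _ => hi2 i]
  gcongr
  have hrow : ∀ i, ∫ ω, ∑ j, inner ℝ (P.noise γ x0 (fun k i => ξ k i ω) t i)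
      (P.noise γ x0 (fun k i => ξ k i ω) t j) ∂μ ≤ σ ^ 2 := by
    intro i
    rw [integral_finsetSum _ fun j _ => hi i j, Finset.sum_eq_single i]
    · simpa only [real_inner_self_eq_norm_sq] using (memLp_noise hN hP hS t i).2
    · intro j _ hji
      refine integral_inner_noise hN hP hS ?_ (memLp_noise hN hP hS t i).1
      exact @measurable_noise _ _ P L σ γ x0 Ω (others ξ t j) ξ hN hP t measurable_others_of_lt i
        (measurable_others fun h => hji (congrArg Prod.snd h).symm)
    · simp
  simpa using Finset.sum_le_sum fun i (_ : i ∈ Finset.univ) => hrow i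

end Integrability

end Problem

/-! ### Linear speedup -/

lemma norm_sq_le_sum {n p : ℕ} (Z : Fin n → Dec p) : ‖Z‖ ^ 2 ≤ ∑ i, ‖Z i‖ ^ 2 := by
  have h : ‖Z‖ ≤ √(∑ i, ‖Z i‖ ^ 2) := by
    refine (pi_norm_le_iff_of_nonneg (Real.sqrt_nonneg _)).2 fun i => Real.le_sqrt_of_sq_le ?_
    exact Finset.single_le_sum (f := fun i => ‖Z i‖ ^ 2) (fun j _ => by positivity)
      (Finset.mem_univ i)
  exact (pow_le_pow_left₀ (norm_nonneg _) h 2).trans_eq (Real.sq_sqrt (by positivity))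

lemma integral_affine {Ω : Type v} [MeasurableSpace Ω] {μ : Measure Ω} [IsProbabilityMeasure μ]
    {A B C D : Ω → ℝ} (hA : Integrable A μ) (hB : Integrable B μ) (hC : Integrable C μ)
    (hD : Integrable D μ) (a b c d e f g : ℝ) :
    Integrable (fun ω => a * (b + (c * A ω + B ω)) + d * (e + f * (C ω + g * D ω))) μ ∧
      ∫ ω, (a * (b + (c * A ω + B ω)) + d * (e + f * (C ω + g * D ω))) ∂μ =
        a * (b + (c * ∫ ω, A ω ∂μ + ∫ ω, B ω ∂μ)) +
          d * (e + f * (∫ ω, C ω ∂μ + g * ∫ ω, D ω ∂μ)) := by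
  have h1 : Integrable (fun ω => c * A ω + B ω) μ := (hA.const_mul c).add hB
  have h2 : Integrable (fun ω => C ω + g * D ω) μ := hC.add (hD.const_mul g)
  have h3 : Integrable (fun ω => b + (c * A ω + B ω)) μ := (integrable_const b).add h1
  have h4 : Integrable (fun ω => e + f * (C ω + g * D ω)) μ :=
    (integrable_const e).add (h2.const_mul f)
  refine ⟨(h3.const_mul a).add (h4.const_mul d), ?_⟩
  rw [integral_add (h3.const_mul a) (h4.const_mul d), integral_const_mul, integral_const_mul,
    integral_add (integrable_const b) h1, integral_add (integrable_const e) (h2.const_mul f),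
    integral_const_mul, integral_add (hA.const_mul c) hB, integral_add hC (hD.const_mul g),
    integral_const_mul, integral_const_mul]
  simp

/-- The pathwise bound in expectation. -/
theorem exists_expected_bound {N : Network} (hg : N.CommonRoot) (hw : N.AdmissibleWeights) {L : ℝ}
    (hL : 0 < L) :
    ∃ K γ₀ : ℝ, 0 ≤ K ∧ 0 < γ₀ ∧ ∀ (p : ℕ) (P : Problem.{u} N.n p) (x0 : Dec p) (σ γ Δ F₀ : ℝ),
      0 < γ → γ ≤ γ₀ → P.NoisyGradients σ → P.Smooth L →
      P.obj x0 - (⨅ x, P.obj x) ≤ Δ →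
      (1 / (N.n : ℝ)) * ∑ i, ‖gradient (P.f i) x0‖ ^ 2 ≤ F₀ →
      ∀ (Ω : Type v) (_ : MeasurableSpace Ω) (μ : Measure Ω), IsProbabilityMeasure μ →
      ∀ ξ : ℕ → ∀ i, Ω → P.S i, P.IsSampling μ ξ → ∀ T : ℕ,
        (∀ t, Integrable (fun ω => ‖gradient P.obj
            (output N P γ x0 (fun k i => ξ k i ω) t)‖ ^ 2) μ) ∧
        ∑ t ∈ Finset.range (T + 1),
            ∫ ω, ‖gradient P.obj (output N P γ x0 (fun k i => ξ k i ω) t)‖ ^ 2 ∂μ ≤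
          8 / (γ * (N.overlap * N.n)) * (Δ + L * γ ^ 2 / 2 *
            (((T : ℝ) + 1) * (N.overlap ^ 2 * (N.n * σ ^ 2)))) +
          K * (N.n * F₀ + γ ^ 2 * (2 * (((T : ℝ) + 1) * (N.n * σ ^ 2)))) := by
  have hn' : (0 : ℝ) < N.n := by exact_mod_cast Network.n_pos hg
  obtain ⟨K, γ₀, hK, hγ₀, hpath⟩ := Network.exists_pathwise_bound hg hw hL
  have hc := Network.overlap_pos hg hw
  refine ⟨K, γ₀, hK, hγ₀, ?_⟩
  intro p P x0 σ γ Δ F₀ hγ hγle hN hP hΔ hF Ω _ μ _ ξ hS T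
  let s : Ω → ℕ → ∀ i, P.S i := fun ω k i => ξ k i ω
  have hgrad : ∀ ω t, gradient P.obj (output N P γ x0 (s ω) t) =
      avgGrad P.grad (N.mid (P.path γ x0 (s ω)) t) := fun ω t => (hP.hasGradientAt_obj _).gradient
  have hiG : ∀ t, Integrable (fun ω => ‖avgGrad P.grad (N.mid (P.path γ x0 (s ω)) t)‖ ^ 2) μ :=
    fun t => (Problem.memLp_avgGrad_comp hP (Problem.memLp_mid hN hP hS t)).norm.integrable_sq
  have hie : ∀ t i, Integrable (fun ω => ‖P.noise γ x0 (s ω) t i‖ ^ 2) μ :=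
    fun t i => (Problem.memLp_noise hN hP hS t i).1.norm.integrable_sq
  have hie' : ∀ t, Integrable (fun ω => ∑ i, ‖P.noise γ x0 (s ω) t i‖ ^ 2) μ :=
    fun t => integrable_finsetSum _ fun i _ => hie t i
  have he : ∀ t, ∫ ω, ∑ i, ‖P.noise γ x0 (s ω) t i‖ ^ 2 ∂μ ≤ N.n * σ ^ 2 := fun t => by
    rw [integral_finsetSum _ fun i _ => hie t i]
    simpa using Finset.sum_le_sum fun i (_ : i ∈ Finset.univ) =>
      (Problem.memLp_noise (γ := γ) (x0 := x0) hN hP hS t i).2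
  have hζ := fun t => Problem.integral_freshNoise_sq_le (γ := γ) (x0 := x0) hN hP hS t
  have hφ := fun t => Problem.integral_testDir_freshNoise (γ := γ) (x0 := x0) hN hP hS t
  have h0 : ∀ ω, ‖localGrad P.grad (P.path γ x0 (s ω)) 0‖ ^ 2 ≤ N.n * F₀ := fun ω => by
    refine (norm_sq_le_sum _).trans ?_
    rw [one_div, inv_mul_le_iff₀ hn'] at hF
    exact hF
  simp only [show ∀ ω, (fun k i => ξ k i ω) = s ω from fun _ => rfl, hgrad] at *
  refine ⟨hiG, ?_⟩
  rw [← integral_finsetSum _ fun t _ => hiG t]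
  -- The pathwise bound, with the sup norms of the noise replaced by sums over the agents.
  have hbound : ∀ ω, ∑ t ∈ Finset.range (T + 1), ‖avgGrad P.grad (N.mid (P.path γ x0 (s ω)) t)‖ ^ 2
      ≤ 8 / (γ * (N.overlap * N.n)) * (Δ + (L * γ ^ 2 / 2 *
            ∑ t ∈ Finset.range (T + 1), ‖N.freshNoise (P.noise γ x0 (s ω)) t‖ ^ 2 +
            ∑ t ∈ Finset.range (T + 1), inner ℝ (N.testDir L γ P.grad (P.path γ x0 (s ω))
              (P.noise γ x0 (s ω)) t) (N.freshNoise (P.noise γ x0 (s ω)) t))) +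
        K * (N.n * F₀ + γ ^ 2 * (∑ t ∈ Finset.range (T + 1), ∑ i, ‖P.noise γ x0 (s ω) t i‖ ^ 2 +
          ((T : ℝ) + 1) * ∑ i, ‖P.noise γ x0 (s ω) 0 i‖ ^ 2)) := fun ω => by
    refine (hpath p P.grad x0 _ _ γ hγ hγle (hP.isRun γ x0 (s ω)) P.obj Δ hP.hasGradientAt_obj
      (hP.obj_sub_le hΔ) T).trans ?_
    gcongr
    · exact h0 ω
    · exact norm_sq_le_sum _
    · exact norm_sq_le_sum _
  have hi1 := integrable_finsetSum (Finset.range (T + 1)) fun t _ => (hζ t).1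
  have hi2 := integrable_finsetSum (Finset.range (T + 1)) fun t _ => (hφ t).1
  have hi3 := integrable_finsetSum (Finset.range (T + 1)) fun t _ => hie' t
  obtain ⟨hi, heq⟩ := integral_affine hi1 hi2 hi3 (hie' 0) (8 / (γ * (N.overlap * N.n))) Δ
    (L * γ ^ 2 / 2) K (N.n * F₀) (γ ^ 2) ((T : ℝ) + 1)
  refine (integral_mono (integrable_finsetSum _ fun t _ => hiG t) hi hbound).trans ?_
  rw [heq, integral_finsetSum _ fun t _ => (hζ t).1, integral_finsetSum _ fun t _ => (hφ t).1,
    integral_finsetSum _ fun t _ => hie' t, Finset.sum_eq_zero fun t _ => (hφ t).2, add_zero]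
  have hs1 : ∑ t ∈ Finset.range (T + 1), ∫ ω, ‖N.freshNoise (P.noise γ x0 (s ω)) t‖ ^ 2 ∂μ ≤
      ((T : ℝ) + 1) * (N.overlap ^ 2 * (N.n * σ ^ 2)) := by
    simpa using Finset.sum_le_sum fun t (_ : t ∈ Finset.range (T + 1)) => (hζ t).2
  have hs2 : ∑ t ∈ Finset.range (T + 1), ∫ ω, ∑ i, ‖P.noise γ x0 (s ω) t i‖ ^ 2 ∂μ ≤
      ((T : ℝ) + 1) * (N.n * σ ^ 2) := by
    simpa using Finset.sum_le_sum fun t (_ : t ∈ Finset.range (T + 1)) => he t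
  have hs3 : ((T : ℝ) + 1) * ∫ ω, ∑ i, ‖P.noise γ x0 (s ω) 0 i‖ ^ 2 ∂μ ≤
      ((T : ℝ) + 1) * (N.n * σ ^ 2) := by gcongr; exact he 0
  rw [two_mul (((T : ℝ) + 1) * (N.n * σ ^ 2))]
  gcongr

/-- The prescribed stepsize balances the two leading terms of the expected bound at the rate of
centralized gradient descent. -/
lemma stepsize_balance {n c Q C Δ σ L τ : ℝ} (hn : 0 < n) (hc : 0 < c) (hQ : 0 < Q) (hΔ : 0 < Δ)
    (hσ : 0 < σ) (hL : 0 < L) (hτ : 0 < τ) (hQC : Q / (n * c ^ 2) ≤ C) (hcQ : n * c ^ 2 ≤ 3 * Q) :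
    Δ / (√(Δ / (Q * σ ^ 2 * L * τ)) * (c * n) * τ) ≤ √C * √(Δ * σ ^ 2 * L / (n * τ)) ∧
      L * √(Δ / (Q * σ ^ 2 * L * τ)) * c * σ ^ 2 ≤ 2 * √(Δ * σ ^ 2 * L / (n * τ)) := by
  have hγ2 := Real.sq_sqrt (show 0 ≤ Δ / (Q * σ ^ 2 * L * τ) by positivity)
  have hγ : 0 < √(Δ / (Q * σ ^ 2 * L * τ)) := by positivity
  set γ := √(Δ / (Q * σ ^ 2 * L * τ))
  have hC : 0 ≤ C := le_trans (by positivity) hQC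
  have hs2 := Real.sq_sqrt (show 0 ≤ Δ * σ ^ 2 * L / (n * τ) by positivity)
  set s := √(Δ * σ ^ 2 * L / (n * τ))
  have hs : 0 ≤ s := Real.sqrt_nonneg _
  constructor
  · refine (abs_le_of_sq_le_sq' ?_ (by positivity)).2
    have e1 : (Δ / (γ * (c * n) * τ)) ^ 2 =
        Q / (n * c ^ 2) * (Δ * σ ^ 2 * L / (n * τ)) := by
      rw [div_pow, mul_pow, mul_pow, hγ2]
      field_simp
    rw [e1, mul_pow, Real.sq_sqrt hC, hs2]
    gcongr
  · refine (abs_le_of_sq_le_sq' ?_ (by positivity)).2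
    have e1 : (L * γ * c * σ ^ 2) ^ 2 = n * c ^ 2 / Q * (Δ * σ ^ 2 * L / (n * τ)) := by
      rw [mul_pow, mul_pow, mul_pow, hγ2]
      field_simp
    rw [e1, mul_pow, hs2]
    gcongr
    rw [div_le_iff₀ hQ]
    linarith

end PushPull

end

theorem mainTheorem3 (𝒩 : Set PushPull.Network)
    (hgraph : ∀ N ∈ 𝒩, N.CommonRoot)
    (hweights : ∀ N ∈ 𝒩, N.AdmissibleWeights)
    (hQ : ∃ C : ℝ, ∀ N ∈ 𝒩,
      max N.M1 (max N.M2tilde (N.M1 * N.M2tilde)) / ((N.n : ℝ) * (N.piR ⬝ᵥ N.piC) ^ 2) ≤ C) :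
    PushPull.LinearSpeedup 𝒩 PushPull.stepsize := by
  obtain ⟨C, hC⟩ := hQ
  -- `8 √C` comes from the initial gap, `8` from the fresh noise, `1` from the higher-order terms.
  refine ⟨8 * √C + 9, fun N hN Δ σ L F₀ hΔ hσ hL => ?_⟩
  have hg := hgraph N hN
  have hw := hweights N hN
  have hn : (0 : ℝ) < N.n := by exact_mod_cast PushPull.Network.n_pos hg
  have hc := PushPull.Network.overlap_pos hg hw
  have hcQ := PushPull.Network.n_mul_overlap_sq_le_Q hw
  have hQC : N.Q / (N.n * N.overlap ^ 2) ≤ C := hC N hN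
  have hQ : 0 < N.Q := by
    have : 0 < (N.n : ℝ) * N.overlap ^ 2 := by positivity
    linarith
  obtain ⟨K, γ₀, hK, hγ₀, hbound⟩ := PushPull.exists_expected_bound hg hw hL
  -- For the prescribed stepsize `γ ^ 2 * (T + 1)` is constant, so the higher-order terms sum to a
  -- constant `B`.
  set B := K * (N.n * F₀ + Δ / (N.Q * σ ^ 2 * L) * (2 * (N.n * σ ^ 2))) with hB
  obtain ⟨T₀, hT₀⟩ := exists_nat_ge
    (max (Δ / (N.Q * σ ^ 2 * L) / γ₀ ^ 2) (B ^ 2 * N.n / (Δ * σ ^ 2 * L)))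
  refine ⟨T₀, fun T hT => ?_⟩
  have hτ : (0 : ℝ) < (T : ℝ) + 1 := by positivity
  have hTT : (T₀ : ℝ) ≤ (T : ℝ) + 1 := by
    have : (T₀ : ℝ) ≤ T := by exact_mod_cast hT
    linarith
  have hγ : 0 < PushPull.stepsize N Δ σ L T := by
    unfold PushPull.stepsize
    positivity
  have hγ2 : PushPull.stepsize N Δ σ L T ^ 2 = Δ / (N.Q * σ ^ 2 * L) / ((T : ℝ) + 1) := by
    rw [PushPull.stepsize, Real.sq_sqrt (by positivity), div_div]
  have hγle : PushPull.stepsize N Δ σ L T ≤ γ₀ := by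
    refine (abs_le_of_sq_le_sq' ?_ hγ₀.le).2
    have h1 := (le_max_left _ _).trans (hT₀.trans hTT)
    rw [hγ2, div_le_iff₀ hτ]
    rwa [div_le_iff₀' (by positivity)] at h1
  obtain ⟨hb1, hb2⟩ := PushPull.stepsize_balance hn hc hQ hΔ hσ hL hτ hQC hcQ
  rw [← PushPull.stepsize] at hb1 hb2
  have hBT : B / ((T : ℝ) + 1) ≤ √(Δ * σ ^ 2 * L / (N.n * ((T : ℝ) + 1))) := by
    refine Real.le_sqrt_of_sq_le ?_
    have h1 := (le_max_right _ _).trans (hT₀.trans hTT)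
    rw [div_le_iff₀ (by positivity)] at h1
    rw [div_pow, div_le_div_iff₀ (by positivity) (by positivity)]
    nlinarith
  refine ⟨hγ, fun p P x0 hNG hP hobj hF Ω mΩ μ hμ ξ hS => ?_⟩
  obtain ⟨hint, hsum⟩ := hbound p P x0 σ _ Δ F₀ hγ hγle hNG hP hobj hF Ω mΩ μ hμ ξ hS T
  refine ⟨fun t _ => hint t, ?_⟩
  set γ := PushPull.stepsize N Δ σ L T
  set s := √(Δ * σ ^ 2 * L / (N.n * ((T : ℝ) + 1)))
  have hKB : K * (N.n * F₀ + γ ^ 2 * (2 * (((T : ℝ) + 1) * (N.n * σ ^ 2)))) = B := by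
    rw [hB, hγ2]
    field_simp
  rw [hKB] at hsum
  have hsplit : 1 / ((T : ℝ) + 1) * (8 / (γ * (N.overlap * N.n)) * (Δ + L * γ ^ 2 / 2 *
      (((T : ℝ) + 1) * (N.overlap ^ 2 * (N.n * σ ^ 2)))) + B) =
      8 * (Δ / (γ * (N.overlap * N.n) * ((T : ℝ) + 1))) + 4 * (L * γ * N.overlap * σ ^ 2) +
        B / ((T : ℝ) + 1) := by
    field_simp
    ring
  have h1 := mul_le_mul_of_nonneg_left hsum (show 0 ≤ 1 / ((T : ℝ) + 1) by positivity)
  rw [hsplit] at h1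
  linarith
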